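/- Let $\mathbb H$ be the upper half-plane, $m,\nu$ positive integers and $k,l$ real numbers. For $\gamma=\begin{pmatrix}a&b\\c&d\end{pmatrix}\in\mathrm{SL}_2(\mathbb Z)$ put $j(\gamma,\tau)=c\tau+d$; complex powers use the principal branch and $e(w):=e^{2\pi i w}$. A multiplier system of weight $k$ on $\mathrm{SL}_2(\mathbb Z)$ is a function $\chi:\mathrm{SL}_2(\mathbb Z)\to\mathbb C$ with $|\chi|=1$ and \[\chi(\gamma_1\gamma_2)\,j(\gamma_1\gamma_2,\tau)^k=\chi(\gamma_1)\chi(\gamma_2)\,j(\gamma_1,\gamma_2\tau)^k\,j(\gamma_2,\tau)^k\] for all $\gamma_1,\gamma_2\in\mathrm{SL}_2(\mathbb Z)$, $\tau\in\mathbb H$. A modular form of weight $l$ and multiplier system $\chi$ is a holomorphic function $g:\mathbb H\to\mathbb C$ with $\chi(\gamma)^{-1}(c\tau+d)^{-l}g(\gamma\tau)=g(\tau)$ for all $\gamma\in\mathrm{SL}_2(\mathbb Z)$ and with an expansion $g(\tau)=\sum_{n\ge 0}a(n+\kappa)\,e((n+\kappa)\tau)$, where $\kappa\in[0,1)$ and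 $\chi\begin{pmatrix}1&1\\0&1\end{pmatrix}=e(\kappa)$. A Jacobi form of weight $k$, index $m$ and multiplier system $\chi$ is a holomorphic function $f:\mathbb H\times\mathbb C\to\mathbb C$ such that for all $\gamma\in\mathrm{SL}_2(\mathbb Z)$ and $(\lambda,\mu)\in\mathbb Z^2$ \[\chi(\gamma)^{-1}f\Big(\gamma\tau,\tfrac{z+\lambda\tau+\mu}{c\tau+d}\Big)(c\tau+d)^{-k}\,e\Big(m\Big(-\tfrac{c(z+\lambda\tau+\mu)^2}{c\tau+d}+\lambda^2\tau+2\lambda z\Big)\Big)=f(\tau,z),\] and such that, for some $\kappa\in[0,1)$, \[f(\tau,z)=\sum_{n,r\in\mathbb Z,\ r^2-4m(n+\kappa)\le 0}c(n+\kappa,r)\,e((n+\kappa)\tau)\,e(rz).\] It is a Jacobi cusp form if moreover $c(n+\kappa,r)=0$ whenever $r^2-4m(n+\kappa)=0$. The spaces of Jacobi forms and of Jacobi cusp forms are denoted $J_{k,m,\chi}$ and $J^{cusp}_{k,m,\chi}$. Let $D_\tau=\frac{1}{2\pi i}\frac{d}{d\tau}$ and $L_m=-\frac1{4\pi^2}\left(8\pi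 i m\frac{\partial}{\partial\tau}-\frac{\partial^2}{\partial z^2}\right)$, and define \[[f,g]^{hol}_{k,m,l,\nu}(\tau,z)=\sum_{r+s=\nu,\ r,s\ge 0}\binom{\nu+k-3/2}{s}\binom{\nu+l-1}{r}(-4m)^s\,L_m^r(f)(\tau,z)\,D_\tau^s(g)(\tau),\] where $\binom{x}{j}=x(x-1)\cdots(x-j+1)/j!$ for real $x$. Proposition. Let $\chi_1$ and $\chi_2$ be multiplier systems of weights $k$ and $l$ on $\mathrm{SL}_2(\mathbb Z)$, let $f\in J_{k,m,\chi_1}$, and let $g$ be a modular form of weight $l$ and multiplier system $\chi_2$. Then $\chi_1\chi_2$ is a multiplier system of weight $k+l+2\nu$, and $[f,g]^{hol}_{k,m,l,\nu}\in J^{cusp}_{k+l+2\nu,m,\chi_1\chi_2}$. -/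

import Mathlib

open scoped UpperHalfPlane MatrixGroups Manifold

noncomputable section

/-- The automorphy factor `c τ + d` of `γ = (a b; c d) ∈ SL₂(ℤ)`. -/
def autFactor (γ : SL(2, ℤ)) (τ : ℍ) : ℂ :=
  ((γ 1 0 : ℤ) : ℂ) * (τ : ℂ) + ((γ 1 1 : ℤ) : ℂ)

/-- `χ` is a (unitary) multiplier system of real weight `k` on `SL₂(ℤ)`; the powers
`(c τ + d) ^ k` are taken with the principal branch, `-π < arg ≤ π`. -/
structure IsMultiplierSystem (k : ℝ) (χ : SL(2, ℤ) → ℂ) : Prop where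
  norm_eq_one : ∀ γ, ‖χ γ‖ = 1
  consistency : ∀ (γ₁ γ₂ : SL(2, ℤ)) (τ : ℍ),
    χ (γ₁ * γ₂) * autFactor (γ₁ * γ₂) τ ^ (k : ℂ) =
      χ γ₁ * χ γ₂ * autFactor γ₁ (γ₂ • τ) ^ (k : ℂ) * autFactor γ₂ τ ^ (k : ℂ)

/-- The exponential `e^{2π i w}`. -/
def expTwoPi (w : ℂ) : ℂ := Complex.exp (2 * (Real.pi : ℂ) * Complex.I * w)

/-- `g` is a modular form of real weight `l` and multiplier system `χ` on `SL₂(ℤ)`. -/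
structure IsRealWeightModularForm (l : ℝ) (χ : SL(2, ℤ) → ℂ) (g : ℍ → ℂ) : Prop where
  holo : MDifferentiable 𝓘(ℂ) 𝓘(ℂ) g
  slash_eq : ∀ (γ : SL(2, ℤ)) (τ : ℍ),
    (χ γ)⁻¹ * autFactor γ τ ^ (-(l : ℂ)) * g (γ • τ) = g τ
  fourier : ∃ κ : ℝ, 0 ≤ κ ∧ κ < 1 ∧ χ ModularGroup.T = expTwoPi κ ∧
    ∃ a : ℕ → ℂ, ∀ τ : ℍ, HasSum (fun n : ℕ => a n * expTwoPi ((n + κ : ℂ) * τ)) (g τ)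

/-- The slash operator `f |_{k,m,χ} [γ, (lam, mu)]` of the Jacobi group `SL₂(ℤ) ⋉ ℤ²`
on functions on `ℍ × ℂ`. -/
def jacobiSlash (k : ℝ) (m : ℕ) (χ : SL(2, ℤ) → ℂ) (f : ℍ × ℂ → ℂ)
    (γ : SL(2, ℤ)) (lam mu : ℤ) : ℍ × ℂ → ℂ := fun p =>
  (χ γ)⁻¹ * f (γ • p.1, (p.2 + lam * (p.1 : ℂ) + mu) / autFactor γ p.1) *
    autFactor γ p.1 ^ (-(k : ℂ)) *
    expTwoPi (m * (-(((γ 1 0 : ℤ) : ℂ) * (p.2 + lam * (p.1 : ℂ) + mu) ^ 2 / autFactor γ p.1) +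
      (lam : ℂ) ^ 2 * (p.1 : ℂ) + 2 * lam * p.2))

/-- `f` has the Fourier expansion
`f(τ,z) = ∑ c(n,r) e^{2π i (n+κ) τ} e^{2π i r z}` over the integers `n`, `r` with
`r² - 4m(n+κ) ≤ 0`; here `c n r` stands for the coefficient `c(n+κ, r)`. -/
def HasJacobiExpansion (m : ℕ) (f : ℍ × ℂ → ℂ) (κ : ℝ) (c : ℤ → ℤ → ℂ) : Prop :=
  (∀ n r : ℤ, 0 < (r : ℝ) ^ 2 - 4 * m * (n + κ) → c n r = 0) ∧
  ∀ (τ : ℍ) (z : ℂ), HasSum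
    (fun x : ℤ × ℤ => c x.1 x.2 * expTwoPi ((x.1 + κ : ℂ) * τ) * expTwoPi (x.2 * z)) (f (τ, z))

/-- `f ∈ J_{k,m,χ}`: Jacobi forms of weight `k`, index `m`, multiplier system `χ`. -/
structure IsJacobiForm (k : ℝ) (m : ℕ) (χ : SL(2, ℤ) → ℂ) (f : ℍ × ℂ → ℂ) : Prop where
  holo : DifferentiableOn ℂ (fun p : ℂ × ℂ => f (UpperHalfPlane.ofComplex p.1, p.2))
    {p | 0 < p.1.im}
  slash_eq : ∀ (γ : SL(2, ℤ)) (lam mu : ℤ), jacobiSlash k m χ f γ lam mu = f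
  fourier : ∃ κ : ℝ, 0 ≤ κ ∧ κ < 1 ∧ ∃ c : ℤ → ℤ → ℂ, HasJacobiExpansion m f κ c

/-- `f ∈ J^{cusp}_{k,m,χ}`: Jacobi forms whose Fourier coefficients `c(n+κ, r)` vanish
whenever `r² - 4m(n+κ) = 0`. -/
structure IsJacobiCuspForm (k : ℝ) (m : ℕ) (χ : SL(2, ℤ) → ℂ) (f : ℍ × ℂ → ℂ) : Prop
    extends IsJacobiForm k m χ f where
  cusp : ∃ κ : ℝ, 0 ≤ κ ∧ κ < 1 ∧ ∃ c : ℤ → ℤ → ℂ, HasJacobiExpansion m f κ c ∧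
    ∀ n r : ℤ, (r : ℝ) ^ 2 - 4 * m * (n + κ) = 0 → c n r = 0

/-- The modified heat operator `L_m = -1/(4π²) (8π i m ∂/∂τ - ∂²/∂z²)`. -/
def heatOp (m : ℕ) (f : ℍ × ℂ → ℂ) : ℍ × ℂ → ℂ := fun p =>
  -(1 / (4 * (Real.pi : ℂ) ^ 2)) *
    (8 * (Real.pi : ℂ) * Complex.I * m *
        deriv (fun t : ℂ => f (UpperHalfPlane.ofComplex t, p.2)) (p.1 : ℂ) -
      iteratedDeriv 2 (fun z : ℂ => f (p.1, z)) p.2)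

/-- The extended `ν`-th Rankin–Cohen bracket
`[f,g]^{hol}_{k,m,l,ν} = ∑_{r+s=ν} C(ν+k-3/2, s) C(ν+l-1, r) (-4m)^s L_m^r(f) D^s(g)`, with
`D = (2π i)⁻¹ d/dτ` and `C(x, j) = x (x-1) ⋯ (x-j+1) / j!` for real `x`. -/
def extendedBracket (k : ℝ) (m : ℕ) (l : ℝ) (ν : ℕ) (f : ℍ × ℂ → ℂ) (g : ℍ → ℂ) :
    ℍ × ℂ → ℂ := fun p =>
  ∑ x ∈ Finset.HasAntidiagonal.antidiagonal ν,
    ((Ring.choose ((ν : ℝ) + k - 3 / 2) x.2 : ℝ) : ℂ) *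
    ((Ring.choose ((ν : ℝ) + l - 1) x.1 : ℝ) : ℂ) *
    (-4 * (m : ℂ)) ^ x.2 * (heatOp m)^[x.1] f p *
    Derivative.normalizedDerivOfComplex^[x.2] g p.1

end

/-! Regard `g` as a function on `ℍ × ℂ` independent of `z`, of index 0. On such functions `L_m` is
`4m D`, so `(-4m)^s D^s g = (-1)^s L_m^s g` and the bracket becomes a classical Rankin–Cohen bracket
for one operator, with `f` behaving as if of weight `k - 1/2`.

Modularity: put `Y = 4m c / (2πi (cτ+d))`. Slashing fails to commute with `L_m` only by a multiple
of `Y`: `(L_m h)|_{w+2} = L_m (h|_w) + (w - 1/2) Y h|_w` in index `m`, and the same with `w` in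
place of `w - 1/2` for functions of `τ` in index 0 (`heatOp_jacobiSlash`,
`heatOp_jacobiSlash_of_forall_eq`). Moreover `L_m Y = -Y²`. Hence the slash of the `r`-th iterate is
a polynomial `P_r(Y)` in the unslashed iterates (`eq_sum_quasimodularCoeff`), with `P_{r+1}' =
(r+1)(κ+r) P_r`. The bracket coefficients are those for which the resulting polynomial in `Y` has
zero derivative. It therefore equals its value at `Y = 0`, which is the bracket itself
(`sum_rankinCohenCoeff_quasimodularPoly`).

Cuspidality: on Fourier coefficients `L_m` is multiplication by `4m(n+κ) - r²`. This discriminant is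
additive when an expansion is multiplied by one with `r = 0` only, so a boundary coefficient of a
product comes only from pairs of boundary coefficients. As `ν ≥ 1`, each summand of the bracket has
at least one factor hit by `L_m`, whose boundary coefficients vanish. -/

/-! ### Absolute convergence of two-variable Fourier series -/

theorem norm_expTwoPi (w : ℂ) : ‖expTwoPi w‖ = Real.exp (-(2 * Real.pi * w.im)) := by
  rw [expTwoPi, Complex.norm_exp]
  congr 1
  simp [Complex.mul_re, Complex.mul_im]

theorem expTwoPi_zero : expTwoPi 0 = 1 := by simp [expTwoPi]

theorem expTwoPi_add (w v : ℂ) : expTwoPi (w + v) = expTwoPi w * expTwoPi v := by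
  rw [expTwoPi, expTwoPi, expTwoPi, ← Complex.exp_add]
  congr 1
  ring

theorem hasDerivAt_expTwoPi (w : ℂ) :
    HasDerivAt expTwoPi (2 * Real.pi * Complex.I * expTwoPi w) w := by
  have h := ((hasDerivAt_id w).const_mul (2 * (Real.pi : ℂ) * Complex.I)).cexp
  have e : expTwoPi = fun w => Complex.exp (2 * (Real.pi : ℂ) * Complex.I * id w) := rfl
  rw [e]
  convert! h using 1
  simp [mul_comm]

theorem HasDerivAt.expTwoPi {u : ℂ → ℂ} {u' t : ℂ} (h : HasDerivAt u u' t) :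
    HasDerivAt (fun t => expTwoPi (u t)) (2 * Real.pi * Complex.I * expTwoPi (u t) * u') t :=
  (hasDerivAt_expTwoPi (u t)).comp t h

/-- Coefficients supported on `n + κ ≥ 0` whose two-variable Fourier series converges absolutely
on `ℍ × ℂ`. -/
structure RapidDecay (κ : ℝ) (c : ℤ → ℤ → ℂ) : Prop where
  supp : ∀ n r : ℤ, (n : ℝ) + κ < 0 → c n r = 0
  summable : ∀ y R : ℝ, 0 < y → Summable fun x : ℤ × ℤ => ‖c x.1 x.2‖ *
    Real.exp (2 * Real.pi * (-((x.1 + κ) * y) + |(x.2 : ℝ)| * R))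

/-- A term of the two-variable Fourier series with coefficients `c`. -/
noncomputable def jacobiTerm (κ : ℝ) (c : ℤ → ℤ → ℂ) (x : ℤ × ℤ) (p : ℂ × ℂ) : ℂ :=
  c x.1 x.2 * expTwoPi ((x.1 + κ : ℂ) * p.1) * expTwoPi (x.2 * p.2)

theorem norm_jacobiTerm (κ : ℝ) (c : ℤ → ℤ → ℂ) (x : ℤ × ℤ) (p : ℂ × ℂ) :
    ‖jacobiTerm κ c x p‖ = ‖c x.1 x.2‖ *
      Real.exp (2 * Real.pi * (-((x.1 + κ) * p.1.im) - x.2 * p.2.im)) := by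
  rw [jacobiTerm, norm_mul, norm_mul, norm_expTwoPi, norm_expTwoPi, mul_assoc, ← Real.exp_add]
  congr 2
  simp [Complex.mul_im]
  ring

theorem RapidDecay.norm_jacobiTerm_le {κ : ℝ} {c : ℤ → ℤ → ℂ} (h : RapidDecay κ c) (x : ℤ × ℤ)
    {p : ℂ × ℂ} {y R : ℝ} (hy : y ≤ p.1.im) (hR : |p.2.im| ≤ R) :
    ‖jacobiTerm κ c x p‖ ≤ ‖c x.1 x.2‖ *
      Real.exp (2 * Real.pi * (-((x.1 + κ) * y) + |(x.2 : ℝ)| * R)) := by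
  rw [norm_jacobiTerm]
  by_cases hx : (x.1 : ℝ) + κ < 0
  · simp [h.supp _ _ hx]
  · push Not at hx
    gcongr _ * Real.exp (2 * Real.pi * ?_)
    have h1 := mul_le_mul_of_nonneg_left hy hx
    have h2 : -(x.2 * p.2.im) ≤ |(x.2 : ℝ)| * R :=
      (neg_le_abs _).trans (by rw [abs_mul]; gcongr)
    linarith

theorem RapidDecay.summable_jacobiTerm {κ : ℝ} {c : ℤ → ℤ → ℂ} (h : RapidDecay κ c) {p : ℂ × ℂ}
    (hp : 0 < p.1.im) : Summable fun x => jacobiTerm κ c x p :=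
  Summable.of_norm_bounded (h.summable _ |p.2.im| hp) fun x => h.norm_jacobiTerm_le x le_rfl le_rfl

/-- Convergence in `ℂ` is absolute, and evaluating at `τ = iy`, `z = ±iR` bounds `e^{2π|r|R}` by the
two exponentials `e^{±2πrR}`. -/
theorem HasJacobiExpansion.rapidDecay {m : ℕ} (hm : 0 < m) {f : ℍ × ℂ → ℂ} {κ : ℝ}
    {c : ℤ → ℤ → ℂ} (h : HasJacobiExpansion m f κ c) : RapidDecay κ c := by
  refine ⟨fun n r hn => h.1 n r ?_, fun y R hy => ?_⟩
  · have : (0 : ℝ) < m := by exact_mod_cast hm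
    nlinarith [sq_nonneg (r : ℝ)]
  · let τ : ℍ := ⟨Complex.I * y, by simpa using hy⟩
    have hs := fun z : ℂ => (h.2 τ z).summable.norm
    have key : ∀ (x : ℤ × ℤ) (z : ℂ), ‖c x.1 x.2 * expTwoPi ((x.1 + κ : ℂ) * τ) *
        expTwoPi (x.2 * z)‖ = ‖c x.1 x.2‖ *
        Real.exp (2 * Real.pi * (-((x.1 + κ) * y) - x.2 * z.im)) := fun x z => by
      have := norm_jacobiTerm κ c x (τ, z)
      rw [jacobiTerm] at this
      simpa [τ] using this
    refine Summable.of_nonneg_of_le (fun x => by positivity) (fun x => ?_)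
      ((hs (Complex.I * R)).add (hs (-(Complex.I * R))))
    rw [key, key, ← mul_add]
    gcongr
    rcases abs_choice (x.2 : ℝ) with e | e <;> rw [e]
    · refine le_add_of_nonneg_of_le (Real.exp_nonneg _) (le_of_eq ?_)
      congr 2; simp
    · refine le_add_of_le_of_nonneg (le_of_eq ?_) (Real.exp_nonneg _)
      congr 2; simp; ring

/-- A multiplier is absorbed by comparing with the series at another height `y'` and a wider strip
`R + R'`, which also converges. -/
theorem RapidDecay.mul_of_le {κ : ℝ} {c : ℤ → ℤ → ℂ} (h : RapidDecay κ c) (q : ℤ → ℤ → ℂ)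
    (hq : ∀ y > 0, ∃ C y' R : ℝ, 0 < y' ∧ ∀ n r : ℤ, 0 ≤ (n : ℝ) + κ →
      ‖q n r‖ ≤ C * Real.exp (2 * Real.pi * (((n + κ) * (y - y')) + |(r : ℝ)| * R))) :
    RapidDecay κ fun n r => q n r * c n r := by
  refine ⟨fun n r hn => by simp [h.supp n r hn], fun y R hy => ?_⟩
  obtain ⟨C, y', R', hy', hC⟩ := hq y hy
  refine Summable.of_nonneg_of_le (fun x => by positivity) (fun x => ?_)
    ((h.summable y' (R + R') hy').mul_left C)
  by_cases hx : (x.1 : ℝ) + κ < 0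
  · simp [h.supp _ _ hx]
  · push Not at hx
    rw [norm_mul]
    calc _ ≤ C * Real.exp (2 * Real.pi * (((x.1 + κ) * (y - y')) + |(x.2 : ℝ)| * R')) *
          ‖c x.1 x.2‖ * Real.exp (2 * Real.pi * (-((x.1 + κ) * y) + |(x.2 : ℝ)| * R)) := by
          gcongr
          exact hC _ _ hx
      _ = C * ‖c x.1 x.2‖ * (Real.exp (2 * Real.pi * (((x.1 + κ) * (y - y')) + |(x.2 : ℝ)| * R')) *
          Real.exp (2 * Real.pi * (-((x.1 + κ) * y) + |(x.2 : ℝ)| * R))) := by ring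
      _ = _ := by
          rw [← Real.exp_add, mul_assoc]
          congr 3
          ring

theorem RapidDecay.const_mul {κ : ℝ} {c : ℤ → ℤ → ℂ} (h : RapidDecay κ c) (a : ℂ) :
    RapidDecay κ fun n r => a * c n r :=
  h.mul_of_le (fun _ _ => a) fun y hy => ⟨‖a‖, y, 0, hy, fun n r _ => by simp⟩

theorem RapidDecay.mul_snd {κ : ℝ} {c : ℤ → ℤ → ℂ} (h : RapidDecay κ c) :
    RapidDecay κ fun n r => r * c n r :=
  h.mul_of_le (fun _ r => r) fun y hy => ⟨1, y, 1, hy, fun n r _ => by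
    have h1 := Real.add_one_le_exp (2 * Real.pi * |(r : ℝ)|)
    have h2 : |(r : ℝ)| ≤ 2 * Real.pi * |(r : ℝ)| :=
      le_mul_of_one_le_left (abs_nonneg _) (by linarith [Real.pi_gt_three])
    simpa using (show |(r : ℝ)| ≤ Real.exp (2 * Real.pi * |(r : ℝ)|) by linarith)⟩

theorem RapidDecay.mul_fst {κ : ℝ} {c : ℤ → ℤ → ℂ} (h : RapidDecay κ c) :
    RapidDecay κ fun n r => (n + κ : ℂ) * c n r :=
  -- Half the height pays for the factor: `x = n + κ` satisfies `x = (2/y)(xy/2) ≤ (2/y)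
  -- e^{2πxy/2}`.
  h.mul_of_le (fun n _ => (n + κ : ℂ)) fun y hy => ⟨2 / y, y / 2, 0, half_pos hy, fun n r hn => by
    have e : ‖(n + κ : ℂ)‖ = n + κ := by
      rw [show (n + κ : ℂ) = ((n + κ : ℝ) : ℂ) by push_cast; rfl, Complex.norm_real,
        Real.norm_of_nonneg hn]
    rw [e]
    have h1 := Real.add_one_le_exp (2 * Real.pi * ((n + κ) * (y / 2)))
    have h2 : (n + κ) * (y / 2) ≤ 2 * Real.pi * ((n + κ) * (y / 2)) :=
      le_mul_of_one_le_left (by positivity) (by linarith [Real.pi_gt_three])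
    rw [div_mul_eq_mul_div, le_div_iff₀ hy]
    have : (n + κ) * (y - y / 2) + |(r : ℝ)| * 0 = (n + κ) * (y / 2) := by ring
    rw [this]
    linarith⟩

/-! ### Termwise differentiation and holomorphy -/

/-- The two-variable Fourier series with coefficients `c`. -/
noncomputable def jacobiSeries (κ : ℝ) (c : ℤ → ℤ → ℂ) (p : ℂ × ℂ) : ℂ :=
  ∑' x, jacobiTerm κ c x p

theorem hasFDerivAt_jacobiTerm (κ : ℝ) (c : ℤ → ℤ → ℂ) (x : ℤ × ℤ) (p : ℂ × ℂ) :
    HasFDerivAt (jacobiTerm κ c x)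
      ((2 * Real.pi * Complex.I * jacobiTerm κ (fun n r => (n + κ : ℂ) * c n r) x p) •
          ContinuousLinearMap.fst ℂ ℂ ℂ +
        (2 * Real.pi * Complex.I * jacobiTerm κ (fun n r => r * c n r) x p) •
          ContinuousLinearMap.snd ℂ ℂ ℂ) p := by
  have h1 := (hasDerivAt_expTwoPi ((x.1 + κ : ℂ) * p.1)).comp_hasFDerivAt p
    ((hasFDerivAt_fst (𝕜 := ℂ) (p := p)).const_mul (x.1 + κ : ℂ))
  have h2 := (hasDerivAt_expTwoPi ((x.2 : ℂ) * p.2)).comp_hasFDerivAt p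
    ((hasFDerivAt_snd (𝕜 := ℂ) (p := p)).const_mul (x.2 : ℂ))
  refine ((h1.const_mul (c x.1 x.2)).mul h2).congr_fderiv ?_
  ext <;> simp [jacobiTerm] <;> ring

theorem RapidDecay.hasFDerivAt_jacobiSeries {κ : ℝ} {c : ℤ → ℤ → ℂ} (h : RapidDecay κ c)
    {p : ℂ × ℂ} (hp : 0 < p.1.im) :
    HasFDerivAt (jacobiSeries κ c)
      ((2 * Real.pi * Complex.I * jacobiSeries κ (fun n r => (n + κ : ℂ) * c n r) p) •
          ContinuousLinearMap.fst ℂ ℂ ℂ +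
        (2 * Real.pi * Complex.I * jacobiSeries κ (fun n r => r * c n r) p) •
          ContinuousLinearMap.snd ℂ ℂ ℂ) p := by
  -- The region `Im τ > y`, `|Im z| < R` is a convex open neighbourhood of `p` on which one summable
  -- majorant controls all the derivatives.
  set y := p.1.im / 2 with hy
  set R := |p.2.im| + 1 with hR
  let s : Set (ℂ × ℂ) := {q | y < q.1.im} ∩ ({q | q.2.im < R} ∩ {q | -R < q.2.im})
  have hs : IsOpen s := (isOpen_lt continuous_const (by fun_prop)).inter
    ((isOpen_lt (by fun_prop) continuous_const).inter (isOpen_lt continuous_const (by fun_prop)))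
  have hlin1 : IsLinearMap ℝ fun q : ℂ × ℂ => q.1.im := ⟨fun _ _ => by simp, fun _ _ => by simp⟩
  have hlin2 : IsLinearMap ℝ fun q : ℂ × ℂ => q.2.im := ⟨fun _ _ => by simp, fun _ _ => by simp⟩
  have hc : Convex ℝ s := (convex_halfSpace_gt hlin1 y).inter
    ((convex_halfSpace_lt hlin2 R).inter (convex_halfSpace_gt hlin2 (-R)))
  have hps : p ∈ s := ⟨by simp only [Set.mem_ofPred_eq]; linarith,
    by simp only [Set.mem_ofPred_eq]; linarith [le_abs_self p.2.im],
    by simp only [Set.mem_ofPred_eq]; linarith [neg_abs_le p.2.im]⟩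
  have hy0 : 0 < y := by positivity
  have A := hasFDerivAt_tsum_of_isPreconnected (𝕜 := ℂ)
    (((h.mul_fst.summable y R hy0).mul_left (2 * Real.pi)).add
      ((h.mul_snd.summable y R hy0).mul_left (2 * Real.pi)))
    hs hc.isPreconnected (fun x q _ => hasFDerivAt_jacobiTerm κ c x q) (fun x q hq => ?_) hps
    (h.summable_jacobiTerm hp) hps
  · refine HasFDerivAt.congr_fderiv A ?_
    rw [Summable.tsum_add]
    · rw [jacobiSeries, jacobiSeries, ← tsum_mul_left, ← tsum_mul_left,
        Summable.tsum_smul_const ((h.mul_fst.summable_jacobiTerm hp).mul_left _),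
        Summable.tsum_smul_const ((h.mul_snd.summable_jacobiTerm hp).mul_left _)]
    · exact ((h.mul_fst.summable_jacobiTerm hp).mul_left _).smul_const _
    · exact ((h.mul_snd.summable_jacobiTerm hp).mul_left _).smul_const _
  · have hq1 : y ≤ q.1.im := hq.1.le
    have hq2 : |q.2.im| ≤ R := abs_le.2 ⟨hq.2.2.le, hq.2.1.le⟩
    have n2 : ‖2 * (Real.pi : ℂ) * Complex.I‖ = 2 * Real.pi := by
      simp [abs_of_pos Real.pi_pos]
    refine (norm_add_le _ _).trans (add_le_add ?_ ?_) <;> rw [norm_smul, norm_mul, n2]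
    · refine (mul_le_of_le_one_right (by positivity) (ContinuousLinearMap.norm_fst_le ℂ ℂ ℂ)).trans ?_
      gcongr
      exact h.mul_fst.norm_jacobiTerm_le x hq1 hq2
    · refine (mul_le_of_le_one_right (by positivity) (ContinuousLinearMap.norm_snd_le ℂ ℂ ℂ)).trans ?_
      gcongr
      exact h.mul_snd.norm_jacobiTerm_le x hq1 hq2

/-- Joint holomorphy of a function on `ℍ × ℂ`. -/
def JacobiHolomorphic (f : ℍ × ℂ → ℂ) : Prop :=
  DifferentiableOn ℂ (fun p : ℂ × ℂ => f (UpperHalfPlane.ofComplex p.1, p.2)) {p | 0 < p.1.im}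

theorem isOpen_setOf_fst_im_pos : IsOpen {p : ℂ × ℂ | 0 < p.1.im} :=
  isOpen_lt continuous_const (by fun_prop)

theorem JacobiHolomorphic.hasFDerivAt {f : ℍ × ℂ → ℂ} (hf : JacobiHolomorphic f) (τ : ℍ) (z : ℂ) :
    HasFDerivAt (fun p : ℂ × ℂ => f (UpperHalfPlane.ofComplex p.1, p.2))
      (fderiv ℂ (fun p : ℂ × ℂ => f (UpperHalfPlane.ofComplex p.1, p.2)) ((τ : ℂ), z))
      ((τ : ℂ), z) :=
  (hf.differentiableAt (isOpen_setOf_fst_im_pos.mem_nhds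
    (show 0 < (τ : ℂ).im from τ.im_pos))).hasFDerivAt

theorem jacobiSeries_eq_of_hasJacobiExpansion {m : ℕ} {f : ℍ × ℂ → ℂ} {κ : ℝ} {c : ℤ → ℤ → ℂ}
    (h : HasJacobiExpansion m f κ c) (τ : ℍ) (z : ℂ) : f (τ, z) = jacobiSeries κ c (τ, z) :=
  (h.2 τ z).tsum_eq.symm

theorem HasJacobiExpansion.eqOn {m : ℕ} {f : ℍ × ℂ → ℂ} {κ : ℝ} {c : ℤ → ℤ → ℂ}
    (h : HasJacobiExpansion m f κ c) :
    Set.EqOn (fun p : ℂ × ℂ => f (UpperHalfPlane.ofComplex p.1, p.2)) (jacobiSeries κ c)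
      {p | 0 < p.1.im} := fun p hp => by
  have hp' : 0 < p.1.im := hp
  simp only [jacobiSeries_eq_of_hasJacobiExpansion h,
    UpperHalfPlane.ofComplex_apply_of_im_pos hp']

theorem HasJacobiExpansion.jacobiHolomorphic {m : ℕ} (hm : 0 < m) {f : ℍ × ℂ → ℂ} {κ : ℝ}
    {c : ℤ → ℤ → ℂ} (h : HasJacobiExpansion m f κ c) : JacobiHolomorphic f :=
  DifferentiableOn.congr (fun _ hp => ((h.rapidDecay hm).hasFDerivAt_jacobiSeries
    hp).differentiableAt.differentiableWithinAt) h.eqOn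

theorem RapidDecay.hasDerivAt_fst {κ : ℝ} {c : ℤ → ℤ → ℂ} (h : RapidDecay κ c)
    {t : ℂ} (ht : 0 < t.im) (z : ℂ) :
    HasDerivAt (fun t => jacobiSeries κ c (t, z))
      (2 * Real.pi * Complex.I * jacobiSeries κ (fun n r => (n + κ : ℂ) * c n r) (t, z)) t := by
  have := (h.hasFDerivAt_jacobiSeries (p := (t, z)) ht).comp_hasDerivAt t
    ((hasDerivAt_id t).prodMk (hasDerivAt_const t z))
  convert! this using 1
  simp

theorem RapidDecay.hasDerivAt_snd {κ : ℝ} {c : ℤ → ℤ → ℂ} (h : RapidDecay κ c)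
    {t : ℂ} (ht : 0 < t.im) (z : ℂ) :
    HasDerivAt (fun z => jacobiSeries κ c (t, z))
      (2 * Real.pi * Complex.I * jacobiSeries κ (fun n r => r * c n r) (t, z)) z := by
  have := (h.hasFDerivAt_jacobiSeries (p := (t, z)) ht).comp_hasDerivAt z
    ((hasDerivAt_const z t).prodMk (hasDerivAt_id z))
  convert! this using 1
  simp

theorem jacobiSeries_const_mul (κ : ℝ) (c : ℤ → ℤ → ℂ) (a : ℂ) (p : ℂ × ℂ) :
    jacobiSeries κ (fun n r => a * c n r) p = a * jacobiSeries κ c p := by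
  rw [jacobiSeries, jacobiSeries, ← tsum_mul_left]
  simp only [jacobiTerm, mul_assoc]

theorem RapidDecay.sub {κ : ℝ} {c d : ℤ → ℤ → ℂ} (hc : RapidDecay κ c) (hd : RapidDecay κ d) :
    RapidDecay κ fun n r => c n r - d n r := by
  refine ⟨fun n r hn => by simp [hc.supp n r hn, hd.supp n r hn], fun y R hy => ?_⟩
  refine Summable.of_nonneg_of_le (fun x => by positivity) (fun x => ?_)
    ((hc.summable y R hy).add (hd.summable y R hy))
  rw [← add_mul]
  gcongr
  exact norm_sub_le _ _

theorem RapidDecay.jacobiSeries_sub {κ : ℝ} {c d : ℤ → ℤ → ℂ} (hc : RapidDecay κ c)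
    (hd : RapidDecay κ d) {p : ℂ × ℂ} (hp : 0 < p.1.im) :
    jacobiSeries κ (fun n r => c n r - d n r) p = jacobiSeries κ c p - jacobiSeries κ d p := by
  rw [jacobiSeries, jacobiSeries, jacobiSeries,
    ← (hc.summable_jacobiTerm hp).tsum_sub (hd.summable_jacobiTerm hp)]
  simp only [jacobiTerm, sub_mul]

/-- Each exponential is an eigenfunction: `∂_τ` gives `2πi(n+κ)` and `∂_z²` gives `(2πi r)²`. Rapid
decay allows this under the sum. -/
theorem HasJacobiExpansion.heatOp {m : ℕ} (hm : 0 < m) {f : ℍ × ℂ → ℂ} {κ : ℝ} {c : ℤ → ℤ → ℂ}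
    (h : HasJacobiExpansion m f κ c) :
    HasJacobiExpansion m (heatOp m f) κ
      (fun n r => (4 * m * (n + κ) - r ^ 2 : ℂ) * c n r) := by
  have hc := h.rapidDecay hm
  have e : (fun n r : ℤ => (4 * m * (n + κ) - r ^ 2 : ℂ) * c n r) =
      fun n r : ℤ => (4 * m : ℂ) * ((n + κ : ℂ) * c n r) - r * (r * c n r) := by
    funext n r; ring
  have hd : RapidDecay κ (fun n r => (4 * m * (n + κ) - r ^ 2 : ℂ) * c n r) := by
    rw [e]
    exact (hc.mul_fst.const_mul _).sub hc.mul_snd.mul_snd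
  refine ⟨fun n r hn => by simp [h.1 n r hn], fun τ z => ?_⟩
  have hτ : 0 < (τ : ℂ).im := τ.im_pos
  have hsum := (hd.summable_jacobiTerm (p := ((τ : ℂ), z)) hτ).hasSum
  convert! hsum using 1
  change _ = jacobiSeries κ _ _
  rw [e, (hc.mul_fst.const_mul _).jacobiSeries_sub hc.mul_snd.mul_snd hτ, jacobiSeries_const_mul]
  have h1 : HasDerivAt (fun t => f (UpperHalfPlane.ofComplex t, z)) _ (τ : ℂ) :=
    (hc.hasDerivAt_fst hτ z).congr_of_eventuallyEq <| by
      filter_upwards [(isOpen_lt continuous_const Complex.continuous_im).mem_nhds hτ] with t ht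
      exact h.eqOn (x := (t, z)) ht
  have h2 : (fun z => f (τ, z)) = fun z => jacobiSeries κ c (τ, z) :=
    funext fun z => jacobiSeries_eq_of_hasJacobiExpansion h τ z
  have h3 : deriv (fun z => jacobiSeries κ c (τ, z)) = fun z => _ :=
    funext fun z => (hc.hasDerivAt_snd hτ z).deriv
  simp only [_root_.heatOp]
  rw [h1.deriv, h2, iteratedDeriv_succ, iteratedDeriv_one, h3,
    ((hc.mul_snd.hasDerivAt_snd hτ z).const_mul _).deriv]
  have hI := Complex.I_sq
  have hpi : (Real.pi : ℂ) ≠ 0 := by exact_mod_cast Real.pi_ne_zero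
  field_simp
  rw [hI]
  ring

theorem HasJacobiExpansion.heatOp_iterate {m : ℕ} (hm : 0 < m) {f : ℍ × ℂ → ℂ} {κ : ℝ}
    {c : ℤ → ℤ → ℂ} (h : HasJacobiExpansion m f κ c) (s : ℕ) :
    HasJacobiExpansion m ((_root_.heatOp m)^[s] f) κ
      (fun n r => (4 * m * (n + κ) - r ^ 2 : ℂ) ^ s * c n r) := by
  induction s with
  | zero => simpa using h
  | succ s ih =>
    rw [Function.iterate_succ_apply']
    convert! ih.heatOp hm using 3
    ring

/-! ### Cusp expansions and their products -/

/-- A Jacobi expansion all of whose coefficients with `r² = 4m(n+κ)` vanish. -/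
def HasCuspExpansion (m : ℕ) (κ : ℝ) (f : ℍ × ℂ → ℂ) : Prop :=
  ∃ c : ℤ → ℤ → ℂ, HasJacobiExpansion m f κ c ∧
    ∀ n r : ℤ, (r : ℝ) ^ 2 - 4 * m * (n + κ) = 0 → c n r = 0

theorem HasCuspExpansion.const_mul {m : ℕ} {κ : ℝ} {f : ℍ × ℂ → ℂ} (h : HasCuspExpansion m κ f)
    (a : ℂ) : HasCuspExpansion m κ fun p => a * f p := by
  obtain ⟨c, hc, hc0⟩ := h
  refine ⟨fun n r => a * c n r, ⟨fun n r hn => by simp [hc.1 n r hn], fun τ z => ?_⟩,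
    fun n r hn => by simp [hc0 n r hn]⟩
  simpa only [mul_assoc] using (hc.2 τ z).mul_left a

theorem HasCuspExpansion.sum {m : ℕ} {κ : ℝ} {ι : Type*} (s : Finset ι) {f : ι → ℍ × ℂ → ℂ}
    (h : ∀ i ∈ s, HasCuspExpansion m κ (f i)) : HasCuspExpansion m κ fun p => ∑ i ∈ s, f i p := by
  have h' : ∀ i, ∃ c : ℤ → ℤ → ℂ, i ∈ s → HasJacobiExpansion m (f i) κ c ∧
      ∀ n r : ℤ, (r : ℝ) ^ 2 - 4 * m * (n + κ) = 0 → c n r = 0 := fun i => by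
    by_cases hi : i ∈ s
    · exact (h i hi).imp fun c hc _ => hc
    -- The value outside `s` is arbitrary; it only makes the chosen family total.
    · exact ⟨0, fun hi' => absurd hi' hi⟩
  choose c hc using h'
  refine ⟨fun n r => ∑ i ∈ s, c i n r, ⟨fun n r hn => Finset.sum_eq_zero fun i hi =>
    (hc i hi).1.1 n r hn, fun τ z => ?_⟩, fun n r hn => Finset.sum_eq_zero fun i hi =>
    (hc i hi).2 n r hn⟩
  simpa only [Finset.sum_mul] using hasSum_sum fun i hi => (hc i hi).1.2 τ z

/-- Needed because the product of expansions has offset `κ + μ`, which can reach or exceed 1. -/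
theorem HasCuspExpansion.shift {m : ℕ} {κ : ℝ} {f : ℍ × ℂ → ℂ} (h : HasCuspExpansion m κ f)
    (j : ℤ) : HasCuspExpansion m (κ - j) f := by
  obtain ⟨c, hc, hc0⟩ := h
  have e : ∀ n : ℤ, ((n - j : ℤ) : ℝ) + κ = n + (κ - j) := fun n => by push_cast; ring
  refine ⟨fun n r => c (n - j) r, ⟨fun n r hn => hc.1 _ _ (by rwa [e]), fun τ z => ?_⟩,
    fun n r hn => hc0 _ _ (by rwa [e])⟩
  rw [← ((Equiv.addRight j).prodCongr (Equiv.refl ℤ)).hasSum_iff]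
  convert! hc.2 τ z using 2 with x
  simp only [Function.comp_apply, Equiv.prodCongr_apply, Prod.map, Equiv.coe_addRight,
    Equiv.refl_apply, add_sub_cancel_right]
  congr 4
  push_cast
  ring

theorem HasSum.convolution {A : Type*} [AddCommGroup A] {u v : A → ℂ} {a b : ℂ}
    (hu : HasSum u a) (hv : HasSum v b) : HasSum (fun x => ∑' y, u (x - y) * v y) (a * b) := by
  -- The shear turns the absolutely convergent double sum into one whose fibres over the first
  -- coordinate are the convolution sums.
  let e : A × A ≃ A × A :=
    ⟨fun x => (x.1 - x.2, x.2), fun x => (x.1 + x.2, x.2), fun x => by simp, fun x => by simp⟩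
  have hs := hu.mul hv (summable_mul_of_summable_norm hu.summable.norm hv.summable.norm)
  have hs' : HasSum (fun x : A × A => u (x.1 - x.2) * v x.2) (a * b) := e.hasSum_iff.2 hs
  exact hs'.prod_fiberwise fun x => (hs'.summable.prod_factor x).hasSum

/-- The product of an expansion with one in which only `r = 0` occurs. -/
theorem HasJacobiExpansion.mul_hasCuspExpansion {m : ℕ} (hm : 0 < m) {f g : ℍ × ℂ → ℂ} {κ μ : ℝ}
    {c d : ℤ → ℤ → ℂ} (hf : HasJacobiExpansion m f κ c) (hg : HasJacobiExpansion m g μ d)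
    (hd : ∀ n r : ℤ, r ≠ 0 → d n r = 0)
    (h0 : (∀ n r : ℤ, (r : ℝ) ^ 2 - 4 * m * (n + κ) = 0 → c n r = 0) ∨
      (∀ n r : ℤ, (r : ℝ) ^ 2 - 4 * m * (n + μ) = 0 → d n r = 0)) :
    HasCuspExpansion m (κ + μ) fun p => f p * g p := by
  have hm' : (0 : ℝ) < m := by exact_mod_cast hm
  -- With `r' = 0` the quantities `r² - 4m(n+·)` of the two factors add up to that of the product.
  -- Both are `≤ 0` on the supports, so a sum `≥ 0` forces both to vanish, and one factor has no
  -- such coefficient.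
  have key : ∀ (n r n' r' : ℤ), (0 ≤ (r : ℝ) ^ 2 - 4 * m * (n + (κ + μ : ℝ))) →
      (0 < (r : ℝ) ^ 2 - 4 * m * (n + (κ + μ : ℝ)) ∨
        (r : ℝ) ^ 2 - 4 * m * (n + (κ + μ : ℝ)) = 0) →
      c (n - n') (r - r') * d n' r' = 0 := fun n r n' r' hnn hn => by
    by_contra hne
    have hc := left_ne_zero_of_mul hne
    have hd' := right_ne_zero_of_mul hne
    have hr : r' = 0 := by by_contra hr; exact hd' (hd _ _ hr)
    subst hr
    have h1 := not_lt.1 (mt (hf.1 _ _) hc)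
    have h2 := not_lt.1 (mt (hg.1 _ _) hd')
    push_cast at h1 h2
    rcases h0 with h0 | h0
    · have h3 := mt (h0 _ _) hc
      push_cast at h3
      apply h3
      linarith
    · have h3 := mt (h0 _ _) hd'
      push_cast at h3
      apply h3
      linarith
  refine ⟨fun n r => ∑' y : ℤ × ℤ, c (n - y.1) (r - y.2) * d y.1 y.2, ⟨fun n r hn => ?_,
    fun τ z => ?_⟩, fun n r hn => ?_⟩
  · simp [key n r _ _ hn.le (Or.inl hn)]
  · convert! (hf.2 τ z).convolution (hg.2 τ z) using 1
    funext x
    rw [mul_assoc, ← tsum_mul_right]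
    congr 1
    funext y
    have e1 : ((x.1 + ((κ + μ : ℝ) : ℂ)) * τ : ℂ) =
        ((x.1 - y.1 : ℤ) + κ) * τ + (y.1 + μ) * τ := by push_cast; ring
    have e2 : (x.2 * z : ℂ) = (x.2 - y.2 : ℤ) * z + y.2 * z := by push_cast; ring
    rw [e1, e2, expTwoPi_add, expTwoPi_add]
    simp only [Prod.fst_sub, Prod.snd_sub]
    ring
  · simp [key n r _ _ hn.ge (Or.inr hn)]

/-! ### Calculus of the automorphy factor and of Möbius substitutions -/

theorem autFactor_eq_denom (γ : SL(2, ℤ)) (τ : ℍ) : autFactor γ τ = UpperHalfPlane.denom γ τ := by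
  simp [autFactor, UpperHalfPlane.denom]

theorem autFactor_ne_zero (γ : SL(2, ℤ)) (τ : ℍ) : autFactor γ τ ≠ 0 := by
  rw [autFactor_eq_denom]
  exact UpperHalfPlane.denom_ne_zero _ _

theorem autFactor_ofComplex (γ : SL(2, ℤ)) {t : ℂ} (ht : 0 < t.im) :
    autFactor γ (UpperHalfPlane.ofComplex t) = (γ 1 0 : ℤ) * t + (γ 1 1 : ℤ) := by
  rw [autFactor, UpperHalfPlane.ofComplex_apply_of_im_pos ht]

theorem hasDerivAt_autFactor_cpow (γ : SL(2, ℤ)) (τ : ℍ) (a : ℂ) :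
    HasDerivAt (fun t : ℂ => (((γ 1 0 : ℤ) : ℂ) * t + ((γ 1 1 : ℤ) : ℂ)) ^ a)
      (a * (γ 1 0 : ℤ) / autFactor γ τ * autFactor γ τ ^ a) τ := by
  -- For `c = 0` the base is the constant `d`, possibly negative and so on the branch cut; for `c ≠
  -- 0` it is never real.
  by_cases hc : γ 1 0 = 0
  · simpa [hc] using hasDerivAt_const (τ : ℂ) (((γ 1 1 : ℤ) : ℂ) ^ a)
  · have hs : ((γ 1 0 : ℤ) : ℂ) * τ + ((γ 1 1 : ℤ) : ℂ) ∈ Complex.slitPlane := by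
      right
      simpa [hc] using τ.im_pos.ne'
    have h := (((hasDerivAt_id (τ : ℂ)).const_mul ((γ 1 0 : ℤ) : ℂ)).add_const
      ((γ 1 1 : ℤ) : ℂ)).cpow_const (c := a) hs
    convert! h using 1
    have h0 := autFactor_ne_zero γ τ
    change _ = a * autFactor γ τ ^ (a - 1) * _
    rw [Complex.cpow_sub _ _ h0, Complex.cpow_one]
    simp only [mul_one]
    ring

theorem coe_smul_eq_div (γ : SL(2, ℤ)) (τ : ℍ) : ((γ • τ : ℍ) : ℂ) =
    ((γ 0 0 : ℤ) * (τ : ℂ) + (γ 0 1 : ℤ)) / autFactor γ τ := by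
  rw [UpperHalfPlane.coe_specialLinearGroup_apply]
  simp [autFactor]

theorem hasDerivAt_moebius (γ : SL(2, ℤ)) (τ : ℍ) :
    HasDerivAt (fun t : ℂ => ((γ 0 0 : ℤ) * t + (γ 0 1 : ℤ)) / ((γ 1 0 : ℤ) * t + (γ 1 1 : ℤ)))
      (1 / autFactor γ τ ^ 2) (τ : ℂ) := by
  have h1 := ((hasDerivAt_id (τ : ℂ)).const_mul ((γ 0 0 : ℤ) : ℂ)).add_const ((γ 0 1 : ℤ) : ℂ)
  have h2 := ((hasDerivAt_id (τ : ℂ)).const_mul ((γ 1 0 : ℤ) : ℂ)).add_const ((γ 1 1 : ℤ) : ℂ)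
  have hdet : ((γ 0 0 : ℤ) : ℂ) * (γ 1 1 : ℤ) - (γ 0 1 : ℤ) * (γ 1 0 : ℤ) = 1 := by
    have := γ.det_coe
    rw [Matrix.det_fin_two] at this
    exact_mod_cast this
  convert! h1.div h2 (autFactor_ne_zero γ τ) using 1
  change _ = _ / autFactor γ τ ^ 2
  congr 1
  simp only [id]
  linear_combination -hdet

theorem JacobiHolomorphic.differentiable_snd {h : ℍ × ℂ → ℂ} (hh : JacobiHolomorphic h) (τ : ℍ) :
    Differentiable ℂ fun z : ℂ => h (τ, z) := fun z => by
  have := (hh.hasFDerivAt τ z).comp_hasDerivAt z ((hasDerivAt_const z (τ : ℂ)).prodMk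
    (hasDerivAt_id z))
  convert! this.differentiableAt using 1
  funext z
  simp

theorem JacobiHolomorphic.differentiableAt_fst {h : ℍ × ℂ → ℂ} (hh : JacobiHolomorphic h) (τ : ℍ)
    (z : ℂ) : DifferentiableAt ℂ (fun t : ℂ => h (UpperHalfPlane.ofComplex t, z)) τ :=
  DifferentiableAt.comp (g := fun p : ℂ × ℂ => h (UpperHalfPlane.ofComplex p.1, p.2))
    (f := fun t : ℂ => (t, z)) (τ : ℂ) (hh.hasFDerivAt τ z).differentiableAt
    (differentiableAt_id.prodMk (differentiableAt_const z))

theorem JacobiHolomorphic.hasDerivAt_comp {h : ℍ × ℂ → ℂ} (hh : JacobiHolomorphic h)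
    {α β : ℂ → ℂ} {α' β' t : ℂ} {τ : ℍ} (hα : HasDerivAt α α' t) (hβ : HasDerivAt β β' t)
    (hτ : α t = τ) :
    HasDerivAt (fun t => h (UpperHalfPlane.ofComplex (α t), β t))
      (α' * deriv (fun s : ℂ => h (UpperHalfPlane.ofComplex s, β t)) (τ : ℂ) +
        β' * deriv (fun z : ℂ => h (τ, z)) (β t)) t := by
  have hF := hh.hasFDerivAt τ (β t)
  set F := fderiv ℂ (fun p : ℂ × ℂ => h (UpperHalfPlane.ofComplex p.1, p.2)) ((τ : ℂ), β t)
  have h1 : HasDerivAt (fun s : ℂ => h (UpperHalfPlane.ofComplex s, β t)) (F (1, 0)) τ :=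
    HasFDerivAt.comp_hasDerivAt (l := fun p : ℂ × ℂ => h (UpperHalfPlane.ofComplex p.1, p.2))
      (l' := F) (τ : ℂ) hF ((hasDerivAt_id (τ : ℂ)).prodMk (hasDerivAt_const (τ : ℂ) (β t)))
  have h2 : HasDerivAt (fun z : ℂ => h (τ, z)) (F (0, 1)) (β t) := by
    convert! hF.comp_hasDerivAt (β t) ((hasDerivAt_const (β t) (τ : ℂ)).prodMk
      (hasDerivAt_id (β t))) using 1
    funext z
    simp
  have h3 := HasFDerivAt.comp_hasDerivAt (l := fun p : ℂ × ℂ =>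
    h (UpperHalfPlane.ofComplex p.1, p.2)) (l' := F) t (by rwa [hτ]) (hα.prodMk hβ)
  rw [h1.deriv, h2.deriv]
  refine HasDerivAt.congr_deriv h3 ?_
  have : ((α', β') : ℂ × ℂ) = α' • (1, 0) + β' • (0, 1) := by simp
  rw [this, map_add, map_smul, map_smul, smul_eq_mul, smul_eq_mul]

theorem eventually_im_pos (τ : ℍ) : ∀ᶠ t : ℂ in nhds (τ : ℂ), 0 < t.im :=
  (isOpen_lt continuous_const Complex.continuous_im).mem_nhds τ.im_pos

/-! ### The heat operator against the slash action -/

/-- The function `c / (2πi (cτ+d))`, scaled by `4m`. -/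
noncomputable def slashDefect (m : ℕ) (γ : SL(2, ℤ)) (τ : ℍ) : ℂ :=
  4 * m * ((γ 1 0 : ℤ) / (2 * Real.pi * Complex.I * autFactor γ τ))

/-- The exponential factor is made so that the first-order terms in `∂_z h` and the quadratic terms
of its exponent cancel between `∂_τ` and `∂_z²`. What survives is `w Y` from differentiating
`(cτ+d)^{-w}` and `-Y/2` from the second `z`-derivative of the exponent. -/
theorem heatOp_jacobiSlash (w : ℝ) (m : ℕ) (χ : SL(2, ℤ) → ℂ) {h : ℍ × ℂ → ℂ}
    (hh : JacobiHolomorphic h) (γ : SL(2, ℤ)) (lam mu : ℤ) (p : ℍ × ℂ) :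
    jacobiSlash (w + 2) m χ (heatOp m h) γ lam mu p =
      heatOp m (jacobiSlash w m χ h γ lam mu) p +
        (w - 1 / 2) * slashDefect m γ p.1 * jacobiSlash w m χ h γ lam mu p := by
  obtain ⟨τ, z⟩ := p
  set J := autFactor γ τ with hJ
  set c : ℂ := ((γ 1 0 : ℤ) : ℂ) with hc
  set d : ℂ := ((γ 1 1 : ℤ) : ℂ) with hd
  have hJ0 : J ≠ 0 := autFactor_ne_zero γ τ
  have hJe : c * τ + d = J := rfl
  set v : ℂ := z + lam * τ + mu with hv
  -- derivative in `τ`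
  have hden : HasDerivAt (fun t : ℂ => c * t + d) c τ := by
    simpa using ((hasDerivAt_id (τ : ℂ)).const_mul c).add_const d
  have hnum : HasDerivAt (fun t : ℂ => z + lam * t + mu) lam τ := by
    simpa using (((hasDerivAt_id (τ : ℂ)).const_mul (lam : ℂ)).const_add z).add_const (mu : ℂ)
  have hexp : HasDerivAt (fun t : ℂ => (m : ℂ) * (-(c * (z + lam * t + mu) ^ 2 / (c * t + d)) +
      (lam : ℂ) ^ 2 * t + 2 * lam * z)) (m * (-2 * c * v * lam / J + c ^ 2 * v ^ 2 / J ^ 2 + lam ^ 2))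
      τ := by
    have h1 := ((hnum.fun_pow 2).const_mul c).fun_div hden (by rw [hJe]; exact hJ0)
    have h2 := ((h1.fun_neg.fun_add ((hasDerivAt_id (τ : ℂ)).const_mul ((lam : ℂ) ^ 2))).add_const
      (2 * lam * z : ℂ)).const_mul (m : ℂ)
    convert! h2 using 1
    simp only [hJe, ← hv]
    field_simp
    ring
  have hτ := (((hh.hasDerivAt_comp (hasDerivAt_moebius γ τ)
    (hnum.fun_div hden (by rw [hJe]; exact hJ0)) (coe_smul_eq_div γ τ).symm).const_mul
    (χ γ)⁻¹).fun_mul (hasDerivAt_autFactor_cpow γ τ (-(w : ℂ)))).fun_mul hexp.expTwoPi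
  have hτ' : HasDerivAt (fun t : ℂ =>
      jacobiSlash w m χ h γ lam mu (UpperHalfPlane.ofComplex t, z)) _ (τ : ℂ) :=
    hτ.congr_of_eventuallyEq <| by
      filter_upwards [eventually_im_pos τ] with t ht
      have e1 := coe_smul_eq_div γ (UpperHalfPlane.ofComplex t)
      rw [autFactor_ofComplex γ ht, UpperHalfPlane.ofComplex_apply_of_im_pos ht] at e1
      simp only [jacobiSlash, autFactor_ofComplex γ ht]
      rw [← e1, UpperHalfPlane.ofComplex_apply, UpperHalfPlane.ofComplex_apply_of_im_pos ht]
  -- derivatives in `z`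
  have hlin : ∀ z : ℂ, HasDerivAt (fun z : ℂ => z + lam * τ + mu) 1 z := fun z =>
    ((hasDerivAt_id z).add_const _).add_const _
  set H : ℂ → ℂ := fun y => h (γ • τ, y) with hH
  have hH1 : Differentiable ℂ H := hh.differentiable_snd (γ • τ)
  have hH2 : Differentiable ℂ (deriv H) := (hH1.contDiff (n := 2)).differentiable_deriv_two
  set V : ℂ → ℂ := fun z => expTwoPi (m * (-(c * (z + lam * τ + mu) ^ 2 / J) + lam ^ 2 * τ +
    2 * lam * z)) with hV
  have hV1 : ∀ z, HasDerivAt V (2 * Real.pi * Complex.I * V z *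
      (m * (-2 * c * (z + lam * τ + mu) / J + 2 * lam))) z := fun z => by
    have h1 := ((((((hlin z).fun_pow 2).const_mul c).div_const J).fun_neg.add_const
      ((lam : ℂ) ^ 2 * τ)).fun_add ((hasDerivAt_id z).const_mul (2 * lam : ℂ))).const_mul (m : ℂ)
    convert! h1.expTwoPi using 1
    simp only [hV, id]
    ring
  have hz : ∀ {K K' : ℂ → ℂ}, (∀ y, HasDerivAt K (K' y) y) → ∀ z : ℂ,
      HasDerivAt (fun z : ℂ => K ((z + lam * τ + mu) / J)) (K' ((z + lam * τ + mu) / J) / J) z :=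
    fun hK z => by
      convert! (hK _).comp z ((hlin z).div_const J) using 1
      ring
  have hu : (fun z : ℂ => jacobiSlash w m χ h γ lam mu (τ, z)) = fun z : ℂ =>
      (χ γ)⁻¹ * H ((z + lam * τ + mu) / J) * J ^ (-(w : ℂ)) * V z := rfl
  have hu1 : deriv (fun z : ℂ => jacobiSlash w m χ h γ lam mu (τ, z)) = fun z : ℂ =>
      (χ γ)⁻¹ * J ^ (-(w : ℂ)) * (deriv H ((z + lam * τ + mu) / J) / J * V z +
        H ((z + lam * τ + mu) / J) * (2 * Real.pi * Complex.I * V z *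
          (m * (-2 * c * (z + lam * τ + mu) / J + 2 * lam)))) := by
    rw [hu]
    funext z
    rw [((((hz (fun y => (hH1 y).hasDerivAt) z).const_mul (χ γ)⁻¹).mul_const
      (J ^ (-(w : ℂ)))).fun_mul (hV1 z)).deriv]
    ring
  have hW1 : ∀ z, HasDerivAt (fun z : ℂ => 2 * Real.pi * Complex.I * V z *
      (m * (-2 * c * (z + lam * τ + mu) / J + 2 * lam))) (2 * Real.pi * Complex.I * (V z *
      (2 * Real.pi * Complex.I * (m * (-2 * c * (z + lam * τ + mu) / J + 2 * lam)) ^ 2 +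
        m * (-2 * c / J)))) z := fun z => by
    have h1 := ((((hlin z).const_mul (-2 * c)).div_const J).add_const (2 * lam : ℂ)).const_mul (m : ℂ)
    convert! ((hV1 z).const_mul (2 * Real.pi * Complex.I)).fun_mul h1 using 1
    ring
  have hu2 := fun z : ℂ => (((((hz (fun y => (hH2 y).hasDerivAt) z).div_const J).fun_mul
    (hV1 z)).fun_add ((hz (fun y => (hH1 y).hasDerivAt) z).fun_mul (hW1 z))).const_mul
    ((χ γ)⁻¹ * J ^ (-(w : ℂ)))).deriv
  have hcp : J ^ (-((w + 2 : ℝ) : ℂ)) = J ^ (-(w : ℂ)) / J ^ 2 := by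
    rw [← Complex.cpow_ofNat J 2, ← Complex.cpow_sub _ _ hJ0]
    congr 1
    push_cast
    ring
  have hVz : expTwoPi (m * (-(c * v ^ 2 / J) + (lam : ℂ) ^ 2 * τ + 2 * lam * z)) = V z := rfl
  have hHv : h (γ • τ, v / J) = H (v / J) := rfl
  have hM : h (UpperHalfPlane.ofComplex (((γ 0 0 : ℤ) * (τ : ℂ) + (γ 0 1 : ℤ)) / J), v / J) =
      H (v / J) := by rw [← coe_smul_eq_div, UpperHalfPlane.ofComplex_apply]
  have hL : heatOp m h (γ • τ, v / J) = -(1 / (4 * (Real.pi : ℂ) ^ 2)) *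
      (8 * (Real.pi : ℂ) * Complex.I * m * deriv (fun s : ℂ => h (UpperHalfPlane.ofComplex s, v / J))
        ((γ • τ : ℍ) : ℂ) - deriv (deriv H) (v / J)) := by
    simp only [heatOp]
    rw [iteratedDeriv_succ, iteratedDeriv_one]
  have hR : heatOp m (jacobiSlash w m χ h γ lam mu) (τ, z) = -(1 / (4 * (Real.pi : ℂ) ^ 2)) *
      (8 * (Real.pi : ℂ) * Complex.I * m *
        deriv (fun t : ℂ => jacobiSlash w m χ h γ lam mu (UpperHalfPlane.ofComplex t, z)) (τ : ℂ) -
      iteratedDeriv 2 (fun z : ℂ => jacobiSlash w m χ h γ lam mu (τ, z)) z) := rfl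
  rw [hτ'.deriv, iteratedDeriv_succ, iteratedDeriv_one, hu1, hu2] at hR
  rw [hR]
  simp only [jacobiSlash, slashDefect, ← hJ, hJe, ← hv, ← hc, ← hd, hcp, hVz, hHv, hL, hM]
  -- All derivatives are now explicit; the rest is a rational identity in independent symbols.
  generalize deriv (fun s : ℂ => h (UpperHalfPlane.ofComplex s, v / J)) ((γ • τ : ℍ) : ℂ) = A
  generalize deriv (deriv H) (v / J) = H2
  generalize deriv H (v / J) = H1
  generalize H (v / J) = H0
  generalize V z = E
  generalize J ^ (-(w : ℂ)) = P
  generalize (χ γ)⁻¹ = X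
  have hpi : (Real.pi : ℂ) ≠ 0 := by exact_mod_cast Real.pi_ne_zero
  have hI := Complex.I_sq
  have hI0 := Complex.I_ne_zero
  field_simp
  ring_nf
  simp only [hI]
  ring

theorem heatOp_of_forall_eq (m : ℕ) {h : ℍ × ℂ → ℂ} (hi : ∀ τ z z', h (τ, z) = h (τ, z'))
    (τ : ℍ) (z : ℂ) : heatOp m h (τ, z) = 4 * m * ((2 * Real.pi * Complex.I)⁻¹ *
      deriv (fun t : ℂ => h (UpperHalfPlane.ofComplex t, z)) (τ : ℂ)) := by
  have hz : (fun y : ℂ => h (τ, y)) = fun _ => h (τ, z) := funext fun y => hi τ y z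
  simp only [heatOp, hz]
  have hpi : (Real.pi : ℂ) ≠ 0 := by exact_mod_cast Real.pi_ne_zero
  have hI0 := Complex.I_ne_zero
  have hI := Complex.I_sq
  simp only [iteratedDeriv_succ, iteratedDeriv_zero, deriv_const', deriv_const, sub_zero]
  field_simp
  rw [hI]
  ring

theorem heatOp_iterate_comp_fst (m : ℕ) (g : ℍ → ℂ) (s : ℕ) :
    (heatOp m)^[s] (fun p => g p.1) =
      fun p => (4 * m : ℂ) ^ s * Derivative.normalizedDerivOfComplex^[s] g p.1 := by
  induction s with
  | zero => simp
  | succ s ih =>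
    rw [Function.iterate_succ_apply', ih, Function.iterate_succ_apply']
    funext ⟨τ, z⟩
    rw [heatOp_of_forall_eq m (fun _ _ _ => rfl)]
    simp only [deriv_const_mul_field', Derivative.normalizedDerivOfComplex, Function.comp_def]
    ring

theorem jacobiSlash_index_zero (w : ℝ) (χ : SL(2, ℤ) → ℂ) (h : ℍ × ℂ → ℂ) (γ : SL(2, ℤ))
    (lam mu : ℤ) (p : ℍ × ℂ) : jacobiSlash w 0 χ h γ lam mu p =
      (χ γ)⁻¹ * h (γ • p.1, (p.2 + lam * (p.1 : ℂ) + mu) / autFactor γ p.1) *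
        autFactor γ p.1 ^ (-(w : ℂ)) := by
  simp [jacobiSlash, expTwoPi_zero]

/-- In index 0 there is no exponential factor, hence no `-1/2`. The operator keeps the index `m`, so
the defect is the same `Y` as for `f`. -/
theorem heatOp_jacobiSlash_of_forall_eq (w : ℝ) (m : ℕ) (χ : SL(2, ℤ) → ℂ) {h : ℍ × ℂ → ℂ}
    (hh : JacobiHolomorphic h) (hi : ∀ τ z z', h (τ, z) = h (τ, z')) (γ : SL(2, ℤ))
    (lam mu : ℤ) (p : ℍ × ℂ) :
    jacobiSlash (w + 2) 0 χ (heatOp m h) γ lam mu p =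
      heatOp m (jacobiSlash w 0 χ h γ lam mu) p +
        w * slashDefect m γ p.1 * jacobiSlash w 0 χ h γ lam mu p := by
  obtain ⟨τ, z⟩ := p
  have hJ0 := autFactor_ne_zero γ τ
  have hcp : autFactor γ τ ^ (-((w + 2 : ℝ) : ℂ)) =
      autFactor γ τ ^ (-(w : ℂ)) / autFactor γ τ ^ 2 := by
    rw [← Complex.cpow_ofNat (autFactor γ τ) 2, ← Complex.cpow_sub _ _ hJ0]
    congr 1
    push_cast
    ring
  have hτ := ((hh.hasDerivAt_comp (hasDerivAt_moebius γ τ)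
    (hasDerivAt_const (τ : ℂ) (0 : ℂ)) (coe_smul_eq_div γ τ).symm).const_mul
    (χ γ)⁻¹).fun_mul (hasDerivAt_autFactor_cpow γ τ (-(w : ℂ)))
  have hτ' : HasDerivAt (fun t : ℂ =>
      jacobiSlash w 0 χ h γ lam mu (UpperHalfPlane.ofComplex t, z)) _ (τ : ℂ) :=
    hτ.congr_of_eventuallyEq <| by
      filter_upwards [eventually_im_pos τ] with t ht
      have e1 := coe_smul_eq_div γ (UpperHalfPlane.ofComplex t)
      rw [autFactor_ofComplex γ ht, UpperHalfPlane.ofComplex_apply_of_im_pos ht] at e1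
      simp only [jacobiSlash_index_zero, autFactor_ofComplex γ ht]
      rw [← e1, UpperHalfPlane.ofComplex_apply, hi _ _ 0,
        UpperHalfPlane.ofComplex_apply_of_im_pos ht]
  rw [heatOp_of_forall_eq m (h := jacobiSlash w 0 χ h γ lam mu) (fun τ z z' => by
    simp only [jacobiSlash_index_zero]; rw [hi]), hτ'.deriv]
  simp only [jacobiSlash_index_zero]
  have e2 : h (UpperHalfPlane.ofComplex (((γ 0 0 : ℤ) * (τ : ℂ) + (γ 0 1 : ℤ)) /
      (((γ 1 0 : ℤ) : ℂ) * τ + ((γ 1 1 : ℤ) : ℂ))), 0) = h (γ • τ, 0) := by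
    rw [show ((γ 1 0 : ℤ) : ℂ) * τ + ((γ 1 1 : ℤ) : ℂ) = autFactor γ τ from rfl,
      ← coe_smul_eq_div, UpperHalfPlane.ofComplex_apply]
  rw [heatOp_of_forall_eq m hi, hi (γ • τ) _ 0, hcp, e2, show (fun t : ℂ => h
    (UpperHalfPlane.ofComplex t, (z + lam * (τ : ℂ) + mu) / autFactor γ τ)) = fun t : ℂ => h
    (UpperHalfPlane.ofComplex t, 0) from funext fun t => hi _ _ _,
    show ((γ 1 0 : ℤ) : ℂ) * τ + ((γ 1 1 : ℤ) : ℂ) = autFactor γ τ from rfl]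
  simp only [slashDefect]
  have hpi : (Real.pi : ℂ) ≠ 0 := by exact_mod_cast Real.pi_ne_zero
  have hI0 := Complex.I_ne_zero
  field_simp
  ring

/-! ### Powers of the defect under the heat operator -/

theorem hasDerivAt_slashDefect (m : ℕ) (γ : SL(2, ℤ)) (τ : ℍ) :
    HasDerivAt (fun t : ℂ => slashDefect m γ (UpperHalfPlane.ofComplex t))
      (-(4 * m * ((γ 1 0 : ℤ) ^ 2 / (2 * Real.pi * Complex.I * autFactor γ τ ^ 2)))) τ := by
  have h2 := ((hasDerivAt_id (τ : ℂ)).const_mul ((γ 1 0 : ℤ) : ℂ)).add_const ((γ 1 1 : ℤ) : ℂ)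
  have h3 := ((h2.fun_inv (autFactor_ne_zero γ τ)).const_mul
    (4 * m * ((γ 1 0 : ℤ) / (2 * Real.pi * Complex.I)) : ℂ))
  refine HasDerivAt.congr_of_eventuallyEq (HasDerivAt.congr_deriv h3 ?_) ?_
  · rw [show ((γ 1 0 : ℤ) : ℂ) * id (τ : ℂ) + ((γ 1 1 : ℤ) : ℂ) = autFactor γ τ from rfl]
    have hJ0 := autFactor_ne_zero γ τ
    have hpi : (Real.pi : ℂ) ≠ 0 := by exact_mod_cast Real.pi_ne_zero
    have hI0 := Complex.I_ne_zero
    field_simp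
  · filter_upwards [eventually_im_pos τ] with t ht
    rw [slashDefect, autFactor_ofComplex γ ht]
    simp only [id, div_eq_mul_inv, mul_inv]
    ring

theorem JacobiHolomorphic.slashDefect_pow_mul {h : ℍ × ℂ → ℂ} (hh : JacobiHolomorphic h) (m : ℕ)
    (γ : SL(2, ℤ)) (j : ℕ) (a : ℂ) :
    JacobiHolomorphic fun p => a * (slashDefect m γ p.1 ^ j * h p) := by
  refine (DifferentiableOn.mul (fun p hp => ?_) hh).const_mul a
  refine (DifferentiableAt.pow ?_ j).differentiableWithinAt
  have hp' : 0 < p.1.im := hp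
  have := (hasDerivAt_slashDefect m γ ⟨p.1, hp'⟩).differentiableAt
  exact DifferentiableAt.comp (g := fun t : ℂ => slashDefect m γ (UpperHalfPlane.ofComplex t))
    (f := Prod.fst) p this _root_.differentiableAt_fst

/-- `L_m` is first order in `τ` and `Y` does not involve `z`, so a Leibniz rule without cross terms
holds, with `L_m Y = -Y²`. -/
theorem heatOp_slashDefect_pow_mul {h : ℍ × ℂ → ℂ} (hh : JacobiHolomorphic h) (m : ℕ)
    (γ : SL(2, ℤ)) (j : ℕ) (a : ℂ) (p : ℍ × ℂ) :
    heatOp m (fun p => a * (slashDefect m γ p.1 ^ j * h p)) p =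
      a * (slashDefect m γ p.1 ^ j * heatOp m h p - j * slashDefect m γ p.1 ^ (j + 1) * h p) := by
  obtain ⟨τ, z⟩ := p
  have h1 := (((hasDerivAt_slashDefect m γ τ).fun_pow j).fun_mul
    (hh.differentiableAt_fst τ z).hasDerivAt).const_mul a
  simp only [heatOp]
  rw [h1.deriv, iteratedDeriv_const_mul_field, iteratedDeriv_const_mul_field,
    UpperHalfPlane.ofComplex_apply]
  have hJ0 := autFactor_ne_zero γ τ
  have hpi : (Real.pi : ℂ) ≠ 0 := by exact_mod_cast Real.pi_ne_zero
  have hI := Complex.I_sq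
  have hI0 := Complex.I_ne_zero
  -- The power rule yields the truncated exponent `j - 1`, so `j = 0` is separate.
  rcases j with _ | j
  · simp
    ring
  · have e : (4 * m * ((γ 1 0 : ℤ) ^ 2 / (2 * Real.pi * Complex.I * autFactor γ τ ^ 2)) : ℂ) *
        (8 * Real.pi * Complex.I * m) = - (4 * Real.pi ^ 2) * slashDefect m γ τ ^ 2 := by
      simp only [slashDefect]
      field_simp
      rw [hI]
      ring
    have e' : (4 * (Real.pi : ℂ) ^ 2) * (1 / (4 * (Real.pi : ℂ) ^ 2)) = 1 := by field_simp
    simp only [Nat.add_sub_cancel]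
    push_cast
    linear_combination (a * (j + 1) * slashDefect m γ τ ^ j * h (τ, z) *
      (1 / (4 * (Real.pi : ℂ) ^ 2))) * e - (a * (j + 1) * slashDefect m γ τ ^ (j + 2) * h (τ, z)) * e'

theorem heatOp_sum (m : ℕ) {ι : Type*} (s : Finset ι) {h : ι → ℍ × ℂ → ℂ}
    (hh : ∀ i ∈ s, JacobiHolomorphic (h i)) (p : ℍ × ℂ) :
    heatOp m (fun p => ∑ i ∈ s, h i p) p = ∑ i ∈ s, heatOp m (h i) p := by
  obtain ⟨τ, z⟩ := p
  simp only [heatOp]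
  rw [deriv_fun_sum fun i hi => (hh i hi).differentiableAt_fst τ z, iteratedDeriv_fun_sum fun i hi =>
    ((hh i hi).differentiable_snd τ).contDiff.contDiffAt, Finset.mul_sum, ← Finset.sum_sub_distrib,
    Finset.mul_sum]

/-! ### Transformation law of the iterates -/

/-- The coefficients `C(r, j) (κ+r-1)(κ+r-2)⋯(κ+r-j)` in the transformation law of the `r`-th
derivative of a form of weight `κ`. -/
noncomputable def quasimodularCoeff (κ : ℂ) (r j : ℕ) : ℂ :=
  r.choose j * ∏ i ∈ Finset.range j, (κ + r - 1 - i)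

theorem quasimodularCoeff_zero_right (κ : ℂ) (r : ℕ) : quasimodularCoeff κ r 0 = 1 := by
  simp [quasimodularCoeff]

theorem quasimodularCoeff_of_lt (κ : ℂ) {r j : ℕ} (h : r < j) : quasimodularCoeff κ r j = 0 := by
  simp [quasimodularCoeff, Nat.choose_eq_zero_of_lt h]

/-- This is the differentiation rule for the polynomials in `Y`, read off on coefficients. -/
theorem succ_mul_quasimodularCoeff (κ : ℂ) (r j : ℕ) :
    (j + 1) * quasimodularCoeff κ (r + 1) (j + 1) = (r + 1) * (κ + r) * quasimodularCoeff κ r j := by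
  have h : ((r + 1).choose (j + 1) : ℂ) * (j + 1) = (r + 1) * r.choose j := by
    exact_mod_cast (Nat.add_one_mul_choose_eq r j).symm
  have hp : ∏ i ∈ Finset.range (j + 1), (κ + (r + 1 : ℕ) - 1 - i) =
      (κ + r) * ∏ i ∈ Finset.range j, (κ + r - 1 - i) := by
    rw [Finset.prod_range_succ', mul_comm]
    congr 1
    · push_cast; ring
    · refine Finset.prod_congr rfl fun i _ => ?_
      push_cast; ring
  rw [quasimodularCoeff, quasimodularCoeff, hp]
  linear_combination (κ + r) * (∏ i ∈ Finset.range j, (κ + r - 1 - i)) * h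

theorem quasimodularCoeff_succ_succ (κ : ℂ) (r j : ℕ) : quasimodularCoeff κ (r + 1) (j + 1) =
    quasimodularCoeff κ r (j + 1) + (κ + 2 * r - j) * quasimodularCoeff κ r j := by
  have h0 : (j + 1 : ℂ) ≠ 0 := by exact_mod_cast j.succ_ne_zero
  have h1 := succ_mul_quasimodularCoeff κ r j
  have h2 : (j + 1) * quasimodularCoeff κ r (j + 1) =
      (r - j) * (κ + r - 1 - j) * quasimodularCoeff κ r j := by
    have : (r.choose (j + 1) : ℂ) * (j + 1) = r.choose j * (r - j) := by
      rcases le_or_gt j r with hj | hj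
      · have := Nat.choose_succ_right_eq r j
        rw [← Nat.cast_sub hj]
        exact_mod_cast this
      · simp [Nat.choose_eq_zero_of_lt hj, Nat.choose_eq_zero_of_lt (hj.trans j.lt_succ_self)]
    rw [quasimodularCoeff, quasimodularCoeff, Finset.prod_range_succ]
    linear_combination (∏ i ∈ Finset.range j, (κ + r - 1 - i)) * (κ + r - 1 - j) * this
  apply mul_left_cancel₀ h0
  linear_combination h1 - h2

/-- `Φ r` stands for the slash of the `r`-th iterate. Applying `L_m + (κ+2r)Y` to `Y^j L_m^{r-j} h`
gives `Y^j L_m^{r+1-j} h` and `(κ+2r-j) Y^{j+1} L_m^{r-j} h`, which is the recursion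
`quasimodularCoeff_succ_succ`. -/
theorem eq_sum_quasimodularCoeff (m : ℕ) (γ : SL(2, ℤ)) (κ : ℂ) {h : ℍ × ℂ → ℂ}
    (hh : ∀ r, JacobiHolomorphic ((heatOp m)^[r] h)) (Φ : ℕ → ℍ × ℂ → ℂ) (h0 : Φ 0 = h)
    (hΦ : ∀ r p, Φ (r + 1) p = heatOp m (Φ r) p + (κ + 2 * r) * slashDefect m γ p.1 * Φ r p)
    (r : ℕ) (p : ℍ × ℂ) : Φ r p = ∑ j ∈ Finset.range (r + 1),
      quasimodularCoeff κ r j * (slashDefect m γ p.1 ^ j * (heatOp m)^[r - j] h p) := by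
  induction r generalizing p with
  | zero => simp [h0, quasimodularCoeff_zero_right]
  | succ r ih =>
    rw [hΦ, show Φ r = _ from funext ih, heatOp_sum m _ fun j _ => (hh (r - j)).slashDefect_pow_mul
      m γ j _]
    simp only [heatOp_slashDefect_pow_mul (hh _)]
    set Y := slashDefect m γ p.1
    have e : ∀ j ∈ Finset.range (r + 1), heatOp m ((heatOp m)^[r - j] h) p =
        (heatOp m)^[r + 1 - j] h p := fun j hj => by
      rw [← Function.iterate_succ_apply' (heatOp m), Nat.succ_sub (Finset.mem_range_succ_iff.1 hj)]
    have s1 : ∑ j ∈ Finset.range (r + 1), quasimodularCoeff κ r j *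
        (Y ^ j * heatOp m ((heatOp m)^[r - j] h) p) =
        ∑ j ∈ Finset.range (r + 1 + 1), quasimodularCoeff κ r j *
        (Y ^ j * (heatOp m)^[r + 1 - j] h p) := by
      -- The added term `j = r + 1` has coefficient zero.
      rw [Finset.sum_range_succ _ (r + 1), quasimodularCoeff_of_lt κ r.lt_succ_self, zero_mul,
        add_zero]
      exact Finset.sum_congr rfl fun j hj => by rw [e j hj]
    have s2 : ∑ j ∈ Finset.range (r + 1), quasimodularCoeff κ (r + 1) (j + 1) *
        (Y ^ (j + 1) * (heatOp m)^[r + 1 - (j + 1)] h p) =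
        ∑ j ∈ Finset.range (r + 1), quasimodularCoeff κ r (j + 1) *
          (Y ^ (j + 1) * (heatOp m)^[r + 1 - (j + 1)] h p) +
        ((κ + 2 * r) * Y * ∑ j ∈ Finset.range (r + 1), quasimodularCoeff κ r j *
          (Y ^ j * (heatOp m)^[r - j] h p) -
        ∑ j ∈ Finset.range (r + 1), quasimodularCoeff κ r j *
          (j * Y ^ (j + 1) * (heatOp m)^[r - j] h p)) := by
      rw [Finset.mul_sum, ← Finset.sum_sub_distrib, ← Finset.sum_add_distrib]
      refine Finset.sum_congr rfl fun j _ => ?_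
      rw [quasimodularCoeff_succ_succ, Nat.add_sub_add_right]
      ring
    simp only [mul_sub, Finset.sum_sub_distrib]
    rw [s1, Finset.sum_range_succ', Finset.sum_range_succ' _ (r + 1), s2,
      quasimodularCoeff_zero_right, quasimodularCoeff_zero_right]
    ring

/-! ### Rankin–Cohen combinatorics -/

theorem Ring.choose_succ_mul (x : ℝ) (j : ℕ) :
    Ring.choose x (j + 1) * (j + 1) = Ring.choose x j * (x - j) := by
  have h := fun n => Ring.descPochhammer_eq_factorial_smul_choose x n
  have h1 := h (j + 1)
  rw [descPochhammer_succ_right, Polynomial.smeval_mul, h j] at h1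
  have h2 : (Polynomial.X - (j : Polynomial ℤ)).smeval x = x - j := by
    simp [Polynomial.smeval_sub, Polynomial.smeval_natCast]
  rw [h2, Nat.factorial_succ, nsmul_eq_mul, nsmul_eq_mul] at h1
  push_cast at h1
  have h0 : (j.factorial : ℝ) ≠ 0 := by exact_mod_cast j.factorial_ne_zero
  apply mul_left_cancel₀ h0
  linear_combination -h1

open Polynomial in
/-- The transform of a sequence of derivatives, as a polynomial in the defect. -/
noncomputable def quasimodularPoly (κ : ℂ) (F : ℕ → ℂ) (r : ℕ) : ℂ[X] :=
  ∑ j ∈ Finset.range (r + 1), C (quasimodularCoeff κ r j * F (r - j)) * X ^ j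

theorem eval_quasimodularPoly (κ : ℂ) (F : ℕ → ℂ) (r : ℕ) (Y : ℂ) :
    (quasimodularPoly κ F r).eval Y =
      ∑ j ∈ Finset.range (r + 1), quasimodularCoeff κ r j * (Y ^ j * F (r - j)) := by
  rw [quasimodularPoly, Polynomial.eval_finsetSum]
  refine Finset.sum_congr rfl fun j _ => ?_
  simp
  ring

theorem eval_zero_quasimodularPoly (κ : ℂ) (F : ℕ → ℂ) (r : ℕ) :
    (quasimodularPoly κ F r).eval 0 = F r := by
  rw [eval_quasimodularPoly, Finset.sum_range_succ']
  simp [quasimodularCoeff_zero_right]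

open Polynomial in
theorem derivative_quasimodularPoly_zero (κ : ℂ) (F : ℕ → ℂ) :
    derivative (quasimodularPoly κ F 0) = 0 := by
  simp [quasimodularPoly]

open Polynomial in
theorem derivative_quasimodularPoly_succ (κ : ℂ) (F : ℕ → ℂ) (r : ℕ) :
    derivative (quasimodularPoly κ F (r + 1)) =
      C ((r + 1) * (κ + r)) * quasimodularPoly κ F r := by
  rw [quasimodularPoly, quasimodularPoly, derivative_sum, Finset.sum_range_succ', Finset.mul_sum]
  simp only [pow_zero, mul_one, derivative_C, add_zero]
  refine Finset.sum_congr rfl fun j _ => ?_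
  rw [derivative_C_mul_X_pow, ← mul_assoc, ← C_mul, Nat.add_sub_add_right, Nat.add_sub_cancel]
  congr 2
  push_cast
  linear_combination F (r - j) * succ_mul_quasimodularCoeff κ r j

/-- The weights of the `ν`-th Rankin–Cohen bracket of forms of weights `κ` and `l`. -/
noncomputable def rankinCohenCoeff (κ l : ℝ) (ν : ℕ) (x : ℕ × ℕ) : ℂ :=
  ((Ring.choose (ν + κ - 1) x.2 : ℝ) : ℂ) * ((Ring.choose (ν + l - 1) x.1 : ℝ) : ℂ) * (-1) ^ x.2

/-- With `ν = r + s + 1`, moving one lower index down in each binomial produces the factors `κ + r`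
and `l + s`; the sign `(-1)^s` makes the two terms opposite. -/
theorem rankinCohenCoeff_relation (κ l : ℝ) {n r s : ℕ} (h : r + s = n) :
    rankinCohenCoeff κ l (n + 1) (r + 1, s) * ((r + 1) * (κ + r)) +
      rankinCohenCoeff κ l (n + 1) (r, s + 1) * ((s + 1) * (l + s)) = 0 := by
  subst h
  have h1 := congrArg (Complex.ofReal) (Ring.choose_succ_mul (((r + s + 1 : ℕ) : ℝ) + κ - 1) s)
  have h2 := congrArg (Complex.ofReal) (Ring.choose_succ_mul (((r + s + 1 : ℕ) : ℝ) + l - 1) r)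
  simp only [rankinCohenCoeff]
  generalize Ring.choose (((r + s + 1 : ℕ) : ℝ) + κ - 1) s = A at *
  generalize Ring.choose (((r + s + 1 : ℕ) : ℝ) + κ - 1) (s + 1) = A' at *
  generalize Ring.choose (((r + s + 1 : ℕ) : ℝ) + l - 1) r = B at *
  generalize Ring.choose (((r + s + 1 : ℕ) : ℝ) + l - 1) (r + 1) = B' at *
  push_cast at h1 h2 ⊢
  linear_combination (A * (κ + r) * (-1) ^ s : ℂ) * h2 - (B * (l + s) * (-1) ^ s : ℂ) * h1

open Polynomial in
theorem sum_rankinCohenCoeff_quasimodularPoly (κ l : ℝ) (ν : ℕ) (F G : ℕ → ℂ) (Y : ℂ) :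
    ∑ x ∈ Finset.HasAntidiagonal.antidiagonal ν, rankinCohenCoeff κ l ν x *
        ((quasimodularPoly κ F x.1).eval Y * (quasimodularPoly l G x.2).eval Y) =
      ∑ x ∈ Finset.HasAntidiagonal.antidiagonal ν, rankinCohenCoeff κ l ν x * (F x.1 * G x.2) := by
  set W : ℂ[X] := ∑ x ∈ Finset.HasAntidiagonal.antidiagonal ν, C (rankinCohenCoeff κ l ν x) *
    (quasimodularPoly κ F x.1 * quasimodularPoly l G x.2) with hW
  have hd : derivative W = 0 := by
    rw [hW, derivative_sum]
    simp only [derivative_mul, derivative_C, zero_mul, zero_add, mul_add, Finset.sum_add_distrib]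
    rcases ν with _ | n
    · simp [derivative_quasimodularPoly_zero]
    -- The end terms carry the derivative of a constant polynomial. After the index shifts, both
    -- remaining sums run over pairs with sum `n` and cancel term by term.
    · rw [Finset.Nat.sum_antidiagonal_succ, Finset.Nat.sum_antidiagonal_succ']
      simp only [derivative_quasimodularPoly_zero, derivative_quasimodularPoly_succ, zero_mul,
        mul_zero, zero_add]
      rw [← Finset.sum_add_distrib]
      refine Finset.sum_eq_zero fun x hx => ?_
      have h := congrArg (C : ℂ → ℂ[X])
        (rankinCohenCoeff_relation κ l (Finset.HasAntidiagonal.mem_antidiagonal.1 hx))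
      simp only [C_add, C_mul, C_0] at h ⊢
      linear_combination (quasimodularPoly κ F x.1 * quasimodularPoly l G x.2) * h
  have hY : W.eval Y = W.eval 0 := by
    rw [eq_C_of_derivative_eq_zero hd, eval_C, eval_C]
  rw [hW] at hY
  simpa [eval_finsetSum, eval_zero_quasimodularPoly] using hY

/-! ### Multiplier systems, modularity and cuspidality of the bracket -/

theorem IsMultiplierSystem.mul {k l : ℝ} {χ₁ χ₂ : SL(2, ℤ) → ℂ} (h₁ : IsMultiplierSystem k χ₁)
    (h₂ : IsMultiplierSystem l χ₂) (ν : ℕ) :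
    IsMultiplierSystem (k + l + 2 * ν) (χ₁ * χ₂) := by
  -- The extra weight `2ν` is an integer, so its power is multiplicative with no branch ambiguity.
  have hpow : ∀ {a : ℂ}, a ≠ 0 → a ^ ((k + l + 2 * ν : ℝ) : ℂ) =
      a ^ (k : ℂ) * a ^ (l : ℂ) * a ^ (2 * ν) := fun {a} ha => by
    rw [← Complex.cpow_natCast a (2 * ν), ← Complex.cpow_add _ _ ha, ← Complex.cpow_add _ _ ha]
    push_cast
    rfl
  refine ⟨fun γ => by simp [h₁.norm_eq_one, h₂.norm_eq_one], fun γ₁ γ₂ τ => ?_⟩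
  have hcoc : autFactor (γ₁ * γ₂) τ = autFactor γ₁ (γ₂ • τ) * autFactor γ₂ τ := by
    have h0 := autFactor_ne_zero γ₂ τ
    rw [autFactor, autFactor, coe_smul_eq_div]
    simp only [Matrix.SpecialLinearGroup.coe_mul, Matrix.mul_apply, Fin.sum_univ_two]
    push_cast
    field_simp
    rw [autFactor]
    ring
  rw [hpow (autFactor_ne_zero _ _), hpow (autFactor_ne_zero _ _), hpow (autFactor_ne_zero _ _)]
  have e1 := h₁.consistency γ₁ γ₂ τ
  have e2 := h₂.consistency γ₁ γ₂ τ
  simp only [Pi.mul_apply]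
  calc _ = (χ₁ (γ₁ * γ₂) * autFactor (γ₁ * γ₂) τ ^ (k : ℂ)) *
        (χ₂ (γ₁ * γ₂) * autFactor (γ₁ * γ₂) τ ^ (l : ℂ)) * autFactor (γ₁ * γ₂) τ ^ (2 * ν) := by ring
    _ = _ := by rw [e1, e2, hcoc]; ring

theorem IsRealWeightModularForm.hasJacobiExpansion {l : ℝ} {χ : SL(2, ℤ) → ℂ} {g : ℍ → ℂ}
    (hg : IsRealWeightModularForm l χ g) (m : ℕ) : ∃ μ : ℝ, 0 ≤ μ ∧ μ < 1 ∧ ∃ d : ℤ → ℤ → ℂ,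
      HasJacobiExpansion m (fun p => g p.1) μ d ∧ ∀ n r : ℤ, r ≠ 0 → d n r = 0 := by
  obtain ⟨μ, h0, h1, -, a, ha⟩ := hg.fourier
  refine ⟨μ, h0, h1, fun n r => if 0 ≤ n ∧ r = 0 then a n.toNat else 0, ⟨fun n r hn => ?_,
    fun τ z => ?_⟩, fun n r hr => if_neg fun h => hr h.2⟩
  · refine if_neg ?_
    rintro ⟨hn0, rfl⟩
    have : (0 : ℝ) ≤ n := by exact_mod_cast hn0
    have : (0 : ℝ) ≤ 4 * m * (n + μ) := by positivity
    push_cast at hn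
    linarith
  · let i : ℕ → ℤ × ℤ := fun n => (n, 0)
    have hi : Function.Injective i := fun a b h => by simpa [i] using h
    rw [← hi.hasSum_iff]
    · convert! ha τ using 2 with n
      simp [i, expTwoPi_zero]
    · rintro ⟨n, r⟩ hx
      have : ¬ (0 ≤ n ∧ r = 0) := by
        rintro ⟨hn, rfl⟩
        exact hx ⟨n.toNat, by simp [i, hn]⟩
      simp [this]

theorem jacobiSlash_mul (w₁ w₂ : ℝ) (m : ℕ) (χ₁ χ₂ : SL(2, ℤ) → ℂ) (A B : ℍ × ℂ → ℂ)
    (γ : SL(2, ℤ)) (lam mu : ℤ) (p : ℍ × ℂ) :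
    jacobiSlash (w₁ + w₂) m (χ₁ * χ₂) (fun p => A p * B p) γ lam mu p =
      jacobiSlash w₁ m χ₁ A γ lam mu p * jacobiSlash w₂ 0 χ₂ B γ lam mu p := by
  rw [jacobiSlash_index_zero]
  simp only [jacobiSlash, Pi.mul_apply, mul_inv]
  rw [show (-((w₁ + w₂ : ℝ) : ℂ)) = -(w₁ : ℂ) + -(w₂ : ℂ) by push_cast; ring,
    Complex.cpow_add _ _ (autFactor_ne_zero γ p.1)]
  ring

/-- The shift `k - 1/2` turns the `3/2` of the definition into the usual `1`, and `(4m)^s` is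
absorbed into `L_m^s g`. -/
theorem extendedBracket_eq_sum (k l : ℝ) (m ν : ℕ) (f : ℍ × ℂ → ℂ) (g : ℍ → ℂ) (p : ℍ × ℂ) :
    extendedBracket k m l ν f g p = ∑ x ∈ Finset.HasAntidiagonal.antidiagonal ν,
      rankinCohenCoeff (k - 1 / 2) l ν x *
        ((heatOp m)^[x.1] f p * (heatOp m)^[x.2] (fun p => g p.1) p) := by
  refine Finset.sum_congr rfl fun x _ => ?_
  rw [heatOp_iterate_comp_fst, rankinCohenCoeff,
    show (ν : ℝ) + (k - 1 / 2) - 1 = ν + k - 3 / 2 by ring,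
    show (-4 * (m : ℂ)) = -1 * (4 * m) by ring, mul_pow]
  ring

theorem IsJacobiForm.jacobiSlash_heatOp_iterate {k : ℝ} {m : ℕ} (hm : 0 < m) {χ : SL(2, ℤ) → ℂ}
    {f : ℍ × ℂ → ℂ} (hf : IsJacobiForm k m χ f) (γ : SL(2, ℤ)) (lam mu : ℤ) (r : ℕ) (p : ℍ × ℂ) :
    jacobiSlash (k + 2 * r) m χ ((heatOp m)^[r] f) γ lam mu p =
      (quasimodularPoly (k - 1 / 2 : ℝ) (fun j => (heatOp m)^[j] f p) r).eval
        (slashDefect m γ p.1) := by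
  obtain ⟨κ, -, -, c, hc⟩ := hf.fourier
  have hh := fun r => (hc.heatOp_iterate hm r).jacobiHolomorphic hm
  rw [eval_quasimodularPoly]
  refine eq_sum_quasimodularCoeff m γ _ hh
    (fun r => jacobiSlash (k + 2 * r) m χ ((heatOp m)^[r] f) γ lam mu) ?_ (fun r p => ?_) r p
  · simpa using hf.slash_eq γ lam mu
  · have := heatOp_jacobiSlash (k + 2 * r) m χ (hh r) γ lam mu p
    rw [Function.iterate_succ_apply',
      show k + 2 * ((r + 1 : ℕ) : ℝ) = k + 2 * r + 2 by push_cast; ring, this]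
    push_cast
    ring

theorem IsRealWeightModularForm.jacobiSlash_heatOp_iterate {l : ℝ} {m : ℕ} (hm : 0 < m)
    {χ : SL(2, ℤ) → ℂ} {g : ℍ → ℂ} (hg : IsRealWeightModularForm l χ g) (γ : SL(2, ℤ))
    (lam mu : ℤ) (s : ℕ) (p : ℍ × ℂ) :
    jacobiSlash (l + 2 * s) 0 χ ((heatOp m)^[s] fun p => g p.1) γ lam mu p =
      (quasimodularPoly l (fun j => (heatOp m)^[j] (fun p => g p.1) p) s).eval
        (slashDefect m γ p.1) := by
  obtain ⟨κ, -, -, d, hd, -⟩ := hg.hasJacobiExpansion m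
  have hh := fun r => (hd.heatOp_iterate hm r).jacobiHolomorphic hm
  rw [eval_quasimodularPoly]
  refine eq_sum_quasimodularCoeff m γ _ hh
    (fun s => jacobiSlash (l + 2 * s) 0 χ ((heatOp m)^[s] fun p => g p.1) γ lam mu) ?_
    (fun s p => ?_) s p
  · funext p
    rw [jacobiSlash_index_zero]
    simp only [Function.iterate_zero, id, Nat.cast_zero, mul_zero, add_zero]
    rw [← hg.slash_eq γ p.1]
    ring
  · have := heatOp_jacobiSlash_of_forall_eq (l + 2 * s) m χ (hh s) (fun τ z z' => by
      rw [heatOp_iterate_comp_fst]) γ lam mu p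
    rw [Function.iterate_succ_apply',
      show l + 2 * ((s + 1 : ℕ) : ℝ) = l + 2 * s + 2 by push_cast; ring, this]
    push_cast
    ring

theorem jacobiSlash_sum (w : ℝ) (m : ℕ) (χ : SL(2, ℤ) → ℂ) {ι : Type*} (s : Finset ι) (a : ι → ℂ)
    (A : ι → ℍ × ℂ → ℂ) (γ : SL(2, ℤ)) (lam mu : ℤ) (p : ℍ × ℂ) :
    jacobiSlash w m χ (fun p => ∑ i ∈ s, a i * A i p) γ lam mu p =
      ∑ i ∈ s, a i * jacobiSlash w m χ (A i) γ lam mu p := by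
  simp only [jacobiSlash, Finset.mul_sum, Finset.sum_mul]
  exact Finset.sum_congr rfl fun i _ => by ring

theorem jacobiSlash_extendedBracket {k l : ℝ} {m : ℕ} (hm : 0 < m) (ν : ℕ)
    {χ₁ χ₂ : SL(2, ℤ) → ℂ} {f : ℍ × ℂ → ℂ} (hf : IsJacobiForm k m χ₁ f) {g : ℍ → ℂ}
    (hg : IsRealWeightModularForm l χ₂ g) (γ : SL(2, ℤ)) (lam mu : ℤ) :
    jacobiSlash (k + l + 2 * ν) m (χ₁ * χ₂) (extendedBracket k m l ν f g) γ lam mu =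
      extendedBracket k m l ν f g := by
  funext p
  rw [show extendedBracket k m l ν f g = _ from funext fun p => extendedBracket_eq_sum k l m ν f g p,
    jacobiSlash_sum]
  -- The slashed bracket is the polynomial evaluated at the defect; it does not depend on the
  -- defect.
  refine Eq.trans ?_ (sum_rankinCohenCoeff_quasimodularPoly (k - 1 / 2) l ν
    (fun j => (heatOp m)^[j] f p) (fun j => (heatOp m)^[j] (fun p => g p.1) p) (slashDefect m γ p.1))
  refine Finset.sum_congr rfl fun x hx => ?_
  rw [← hf.jacobiSlash_heatOp_iterate hm γ lam mu, ← hg.jacobiSlash_heatOp_iterate hm γ lam mu,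
    ← jacobiSlash_mul, ← Finset.HasAntidiagonal.mem_antidiagonal.1 hx,
    show k + l + 2 * ((x.1 + x.2 : ℕ) : ℝ) = k + 2 * x.1 + (l + 2 * x.2) by push_cast; ring]

theorem hasCuspExpansion_extendedBracket {k l : ℝ} {m ν : ℕ} (hm : 0 < m) (hν : 0 < ν)
    {f : ℍ × ℂ → ℂ} {g : ℍ → ℂ} {κ μ : ℝ} {c d : ℤ → ℤ → ℂ} (hc : HasJacobiExpansion m f κ c)
    (hd : HasJacobiExpansion m (fun p => g p.1) μ d) (hd0 : ∀ n r : ℤ, r ≠ 0 → d n r = 0) :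
    HasCuspExpansion m (κ + μ) (extendedBracket k m l ν f g) := by
  have hvan : ∀ (κ : ℝ) (c : ℤ → ℤ → ℂ) (j : ℕ), j ≠ 0 → ∀ n r : ℤ,
      (r : ℝ) ^ 2 - 4 * m * (n + κ) = 0 → (4 * m * (n + κ) - r ^ 2 : ℂ) ^ j * c n r = 0 :=
    fun κ c j hj n r h => by
      have h' : (4 * m * (n + κ) - r ^ 2 : ℂ) = ((-((r : ℝ) ^ 2 - 4 * m * (n + κ)) : ℝ) : ℂ) := by
        push_cast; ring
      rw [h', h]
      simp [hj]
  rw [show extendedBracket k m l ν f g = _ from funext fun p => extendedBracket_eq_sum k l m ν f g p]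
  refine HasCuspExpansion.sum _ fun x hx => HasCuspExpansion.const_mul
    ((hc.heatOp_iterate hm x.1).mul_hasCuspExpansion hm (hd.heatOp_iterate hm x.2)
      (fun n r hr => by simp [hd0 n r hr]) ?_) _
  have hx' := Finset.HasAntidiagonal.mem_antidiagonal.1 hx
  -- Since `r + s = ν > 0`, `L_m` acts at least once on `f` or on `g`.
  rcases Nat.eq_zero_or_pos x.1 with h1 | h1
  · exact Or.inr (hvan _ _ _ (by omega))
  · exact Or.inl (hvan _ _ _ h1.ne')

theorem mainTheorem9 (k l : ℝ) (m ν : ℕ) (hm : 0 < m) (hν : 0 < ν)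
    (χ₁ χ₂ : SL(2, ℤ) → ℂ)
    (hχ₁ : IsMultiplierSystem k χ₁) (hχ₂ : IsMultiplierSystem l χ₂)
    (f : ℍ × ℂ → ℂ) (hf : IsJacobiForm k m χ₁ f)
    (g : ℍ → ℂ) (hg : IsRealWeightModularForm l χ₂ g) :
    IsMultiplierSystem (k + l + 2 * ν) (χ₁ * χ₂) ∧
      IsJacobiCuspForm (k + l + 2 * ν) m (χ₁ * χ₂) (extendedBracket k m l ν f g) := by
  obtain ⟨κ, hκ0, hκ1, c, hc⟩ := hf.fourier
  obtain ⟨μ, hμ0, hμ1, d, hd, hd0⟩ := hg.hasJacobiExpansion m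
  have hcusp := hasCuspExpansion_extendedBracket (k := k) (l := l) hm hν hc hd hd0
  -- The offset is reduced to `ρ`, the fractional part of `κ + μ`.
  obtain ⟨ρ, hρ0, hρ1, e, he, he0⟩ : ∃ ρ : ℝ, 0 ≤ ρ ∧ ρ < 1 ∧
      HasCuspExpansion m ρ (extendedBracket k m l ν f g) := by
    have h := hcusp.shift ⌊κ + μ⌋
    exact ⟨_, Int.fract_nonneg (κ + μ), Int.fract_lt_one (κ + μ), h⟩
  exact ⟨hχ₁.mul hχ₂ ν, ⟨he.jacobiHolomorphic hm,
    jacobiSlash_extendedBracket hm ν hf hg, ρ, hρ0, hρ1, e, he⟩, ρ, hρ0, hρ1, e, he, he0⟩
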